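/- Let $(M_{2k},\varphi,g)$ be an anti-paraKähler manifold: $g$ is a smooth Riemannian metric on the smooth $2k$-dimensional manifold $M$ with Levi-Civita connection $\nabla$, and $\varphi$ is a smooth field of endomorphisms of $TM$ with $\varphi^2=\mathrm{id}$, with $\pm1$-eigenbundles of equal rank, $g(\varphi X,\varphi Y)=g(X,Y)$ and $\nabla\varphi=0$. Let $\delta\in\mathbb R$. In a chart $(x^i)$ of $M$, with induced coordinates $(x^i,u^i)$ on $TM$, put $E_h=\partial/\partial x^h-\Gamma^k_{hj}u^j\,\partial/\partial u^k$ and $E_{\bar h}=\partial/\partial u^h$ (so that ${}^HX=X^hE_h$, ${}^VX=X^hE_{\bar h}$). The Berger type deformed Sasaki metric $g_{BS}$ on $TM$ is given at $u\in TM$ by $$g_{BS}({}^HX,{}^HY)=g(X,Y),\quad g_{BS}({}^VX,{}^HY)=0,\quad g_{BS}({}^VX,{}^VY)=g(X,Y)+\delta^2g(X,\varphi u)\,g(Y,\varphi u).$$ For a map $f$ between Riemannian manifolds, given in coordinates by $f^\gamma$, put $$\beta(f)(\partial_i,\partial_j)^\gamma=\frac{\partial^2f^\gamma}{\partial x^i\partial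 x^j}-\Gamma^k_{ij}\frac{\partial f^\gamma}{\partial x^k}+\Gamma'^{\gamma}_{\alpha\beta}\frac{\partial f^\alpha}{\partial x^i}\frac{\partial f^\beta}{\partial x^j},\qquad \tau(f)=g^{ij}\beta(f)(\partial_i,\partial_j),$$ where $\Gamma$ and $\Gamma'$ are the Christoffel symbols of the source and of the target. Let $\xi$ be a smooth vector field on $M$, considered as a map $\xi:(M,g)\to(TM,g_{BS})$. Then, in every chart of $M$ and at every point of its domain, with $E_h$ and $E_{\bar h}$ taken at $\xi$, $$\beta(\xi)(\partial_i,\partial_j)=\tfrac12\big\{(\nabla_j\xi^l)R^{h}_{\,.\,ilm}\xi^m+(\nabla_i\xi^l)R^{h}_{\,.\,jlm}\xi^m\big\}E_h+\big\{-\tfrac12R_{ijm}{}^{h}\xi^m+\nabla_i\nabla_j\xi^h+(\nabla_i\xi^m)(\nabla_j\xi^n)A^h_{mn}\big\}E_{\bar h},$$ $$\tau(\xi)=\big\{g^{ij}(\nabla_j\xi^l)R^{h}_{\,.\,ilm}\xi^m\big\}E_h+\big\{g^{ij}\nabla_i\nabla_j\xi^h+g^{ij}(\nabla_i\xi^m)(\nabla_j\xi^n)A^h_{mn}\big\}E_{\bar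 h}.$$ Here $R(\partial_i,\partial_j)\partial_k=R_{ijk}{}^{h}\partial_h$ with $R(X,Y)=[\nabla_X,\nabla_Y]-\nabla_{[X,Y]}$, $R^{h}_{\,.\,jki}=R_{ljk}{}^{s}g^{lh}g_{si}$, $\nabla_i\nabla_j\xi^h$ are the components $\partial_i(\nabla_j\xi^h)-\Gamma^k_{ij}\nabla_k\xi^h+\Gamma^h_{ik}\nabla_j\xi^k$ of the second covariant derivative, and $$A^h_{mn}=\frac{\delta^2}{1+\delta^2g(\xi,\xi)}\,\varphi^k_n\,\varphi^h_l\,\xi^l\,g_{mk}.$$ -/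

import Mathlib

open scoped Manifold ContDiff

noncomputable section

namespace BergerSasaki

/-! ### Local tensor calculus on coordinate space

A metric on a coordinate domain is a matrix-valued function `G`, and connection coefficients are
functions `C x h i j`, standing for the symbol with upper index `h` and lower indices `i`, `j`. -/

section Coordinates

variable {ι κ : Type*} [Fintype ι] [DecidableEq ι] [Fintype κ] [DecidableEq κ]

/-- The partial derivative `∂F/∂x^i` at `x`. -/
def partialDeriv (i : ι) (F : EuclideanSpace ℝ ι → ℝ) (x : EuclideanSpace ℝ ι) : ℝ :=
  fderiv ℝ F x (EuclideanSpace.single i 1)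

/-- The Christoffel symbol `Γ^h_{ij}` of the metric with component matrix `G`. -/
def christoffel (G : EuclideanSpace ℝ ι → Matrix ι ι ℝ) (x : EuclideanSpace ℝ ι) (h i j : ι) : ℝ :=
  (1 / 2) * ∑ l, (G x)⁻¹ h l *
    (partialDeriv i (fun y => G y j l) x + partialDeriv j (fun y => G y i l) x
      - partialDeriv l (fun y => G y i j) x)

/-- The second fundamental form of a map `f` between coordinate domains with metrics `G`, `G'`:
`secondFundamentalForm G G' f x i j γ` is the component
`∂²f^γ/∂x^i∂x^j - Γ^k_{ij} ∂f^γ/∂x^k + Γ'^γ_{αβ}(f(x)) ∂f^α/∂x^i ∂f^β/∂x^j`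
of `β(f)(∂/∂x^i, ∂/∂x^j)`. -/
def secondFundamentalForm (G : EuclideanSpace ℝ ι → Matrix ι ι ℝ)
    (G' : EuclideanSpace ℝ κ → Matrix κ κ ℝ) (f : EuclideanSpace ℝ ι → EuclideanSpace ℝ κ)
    (x : EuclideanSpace ℝ ι) (i j : ι) (γ : κ) : ℝ :=
  partialDeriv i (fun y => partialDeriv j (fun w => f w γ) y) x
    - ∑ k, christoffel G x k i j * partialDeriv k (fun w => f w γ) x
    + ∑ α, ∑ β, christoffel G' (f x) γ α β
        * partialDeriv i (fun w => f w α) x * partialDeriv j (fun w => f w β) x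

/-- The tension field `τ(f)^γ = g^{ij} β(f)(∂/∂x^i, ∂/∂x^j)^γ`. -/
def tensionField (G : EuclideanSpace ℝ ι → Matrix ι ι ℝ)
    (G' : EuclideanSpace ℝ κ → Matrix κ κ ℝ) (f : EuclideanSpace ℝ ι → EuclideanSpace ℝ κ)
    (x : EuclideanSpace ℝ ι) (γ : κ) : ℝ :=
  ∑ i, ∑ j, (G x)⁻¹ i j * secondFundamentalForm G G' f x i j γ

/-- `covDeriv G V x i h` is `∇_i V^h = ∂_i V^h + Γ^h_{ik} V^k`. -/
def covDeriv (G : EuclideanSpace ℝ ι → Matrix ι ι ℝ) (V : EuclideanSpace ℝ ι → EuclideanSpace ℝ ι)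
    (x : EuclideanSpace ℝ ι) (i h : ι) : ℝ :=
  partialDeriv i (fun y => V y h) x + ∑ k, christoffel G x h i k * V x k

/-- `covDeriv₂ G V x i j h` is the component `∇_i ∇_j V^h` of the second covariant derivative,
that is `∂_i (∇_j V^h) - Γ^k_{ij} ∇_k V^h + Γ^h_{ik} ∇_j V^k`. -/
def covDeriv₂ (G : EuclideanSpace ℝ ι → Matrix ι ι ℝ)
    (V : EuclideanSpace ℝ ι → EuclideanSpace ℝ ι) (x : EuclideanSpace ℝ ι) (i j h : ι) : ℝ :=
  partialDeriv i (fun y => covDeriv G V y j h) x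
    - ∑ k, christoffel G x k i j * covDeriv G V x k h
    + ∑ k, christoffel G x h i k * covDeriv G V x j k

/-- `curvature G x i j k h` is the component `R_{ijk}{}^h`, where
`R(∂_i, ∂_j) ∂_k = R_{ijk}{}^h ∂_h` and `R(X, Y) = [∇_X, ∇_Y] - ∇_{[X, Y]}`. -/
def curvature (G : EuclideanSpace ℝ ι → Matrix ι ι ℝ) (x : EuclideanSpace ℝ ι)
    (i j k h : ι) : ℝ :=
  partialDeriv i (fun y => christoffel G y h j k) x
    - partialDeriv j (fun y => christoffel G y h i k) x
    + ∑ l, (christoffel G x h i l * christoffel G x l j k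
        - christoffel G x h j l * christoffel G x l i k)

/-- `curvatureUp G x h j k i` is `R^h{}_{.jki} = R_{ljk}{}^s g^{lh} g_{si}`. -/
def curvatureUp (G : EuclideanSpace ℝ ι → Matrix ι ι ℝ) (x : EuclideanSpace ℝ ι)
    (h j k i : ι) : ℝ :=
  ∑ l, ∑ s, curvature G x l j k s * (G x)⁻¹ l h * G x s i

/-- `covDerivEndo G P x k i h` is `∇_k P_i^h = ∂_k P_i^h + Γ^h_{kl} P_i^l - Γ^l_{ki} P_l^h` for a
field of endomorphisms `P`, whose component `P_i^h` is the matrix entry in row `h`, column `i`. -/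
def covDerivEndo (G P : EuclideanSpace ℝ ι → Matrix ι ι ℝ) (x : EuclideanSpace ℝ ι)
    (k i h : ι) : ℝ :=
  partialDeriv k (fun y => P y h i) x
    + ∑ l, (christoffel G x h k l * P x l i - christoffel G x l k i * P x h l)

end Coordinates

/-! ### Coordinates on the tangent bundle

A point of `π⁻¹(U)`, or a tangent vector to it, has coordinates indexed by `Fin n ⊕ Fin n`:
the base coordinates `x^i` are those with index `inl i`, the fibre coordinates `u^i` those with
index `inr i`. -/

section TangentCoordinates

variable {n : ℕ}

/-- The point (or vector) with base coordinates `x` and fibre coordinates `u`. -/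
def pair (x u : EuclideanSpace ℝ (Fin n)) : EuclideanSpace ℝ (Fin n ⊕ Fin n) :=
  WithLp.toLp 2 (Sum.elim (fun i => x i) (fun i => u i))

/-- The base coordinates. -/
def base (z : EuclideanSpace ℝ (Fin n ⊕ Fin n)) : EuclideanSpace ℝ (Fin n) :=
  WithLp.toLp 2 (fun i => z (Sum.inl i))

/-- The fibre coordinates. -/
def fibre (z : EuclideanSpace ℝ (Fin n ⊕ Fin n)) : EuclideanSpace ℝ (Fin n) :=
  WithLp.toLp 2 (fun i => z (Sum.inr i))

@[simp] lemma base_pair (x u : EuclideanSpace ℝ (Fin n)) : base (pair x u) = x := rfl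

@[simp] lemma fibre_pair (x u : EuclideanSpace ℝ (Fin n)) : fibre (pair x u) = u := rfl

/-- The vector with components `Γ^h_{ij} a^i u^j`. -/
def christoffelVec (G : EuclideanSpace ℝ (Fin n) → Matrix (Fin n) (Fin n) ℝ)
    (x a u : EuclideanSpace ℝ (Fin n)) : EuclideanSpace ℝ (Fin n) :=
  WithLp.toLp 2 (fun h => ∑ i, ∑ j, christoffel G x h i j * a i * u j)

/-- The horizontal lift `a^i E_i` to the point `z` of the vector `a^i ∂/∂x^i`, where
`E_i = ∂/∂x^i - Γ^h_{ij} u^j ∂/∂u^h`. -/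
def horizontalLift (G : EuclideanSpace ℝ (Fin n) → Matrix (Fin n) (Fin n) ℝ)
    (z : EuclideanSpace ℝ (Fin n ⊕ Fin n)) (a : EuclideanSpace ℝ (Fin n)) :
    EuclideanSpace ℝ (Fin n ⊕ Fin n) :=
  pair a (-christoffelVec G (base z) a (fibre z))

/-- The vertical lift `a^i ∂/∂u^i` of the vector `a^i ∂/∂x^i`. -/
def verticalLift (a : EuclideanSpace ℝ (Fin n)) : EuclideanSpace ℝ (Fin n ⊕ Fin n) :=
  pair 0 a

/-- The adapted frame vector `E_h` at `z`. -/
def frameH (G : EuclideanSpace ℝ (Fin n) → Matrix (Fin n) (Fin n) ℝ)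
    (z : EuclideanSpace ℝ (Fin n ⊕ Fin n)) (h : Fin n) : EuclideanSpace ℝ (Fin n ⊕ Fin n) :=
  horizontalLift G z (EuclideanSpace.single h 1)

/-- The adapted frame vector `E_{h̄} = ∂/∂u^h`. -/
def frameV (h : Fin n) : EuclideanSpace ℝ (Fin n ⊕ Fin n) :=
  verticalLift (EuclideanSpace.single h 1)

/-- The vertical component `δu(a)` of a vector `a` tangent at `z`, with
`δu^h = du^h + Γ^h_{ij} u^j dx^i`. -/
def connector (G : EuclideanSpace ℝ (Fin n) → Matrix (Fin n) (Fin n) ℝ)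
    (z a : EuclideanSpace ℝ (Fin n ⊕ Fin n)) : EuclideanSpace ℝ (Fin n) :=
  fibre a + christoffelVec G (base z) (base a) (fibre z)

@[simp] lemma base_horizontalLift (G : EuclideanSpace ℝ (Fin n) → Matrix (Fin n) (Fin n) ℝ)
    (z : EuclideanSpace ℝ (Fin n ⊕ Fin n)) (a : EuclideanSpace ℝ (Fin n)) :
    base (horizontalLift G z a) = a := rfl

@[simp] lemma base_verticalLift (a : EuclideanSpace ℝ (Fin n)) :
    base (verticalLift a) = 0 := rfl

@[simp] lemma connector_horizontalLift (G : EuclideanSpace ℝ (Fin n) → Matrix (Fin n) (Fin n) ℝ)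
    (z : EuclideanSpace ℝ (Fin n ⊕ Fin n)) (a : EuclideanSpace ℝ (Fin n)) :
    connector G z (horizontalLift G z a) = 0 := by
  simp [connector, horizontalLift]

@[simp] lemma connector_verticalLift (G : EuclideanSpace ℝ (Fin n) → Matrix (Fin n) (Fin n) ℝ)
    (z : EuclideanSpace ℝ (Fin n ⊕ Fin n)) (a : EuclideanSpace ℝ (Fin n)) :
    connector G z (verticalLift a) = a := by
  ext h
  simp [connector, verticalLift, christoffelVec]

end TangentCoordinates

/-! ### Anti-paraKähler manifolds and the Berger type deformed Sasaki metric -/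

section Manifold

variable {n : ℕ} {M : Type*} [TopologicalSpace M] [ChartedSpace (EuclideanSpace ℝ (Fin n)) M]

/-- The tangent vector `a^i ∂/∂x^i` to `M` at the point with coordinates `x` in the chart `e`. -/
def tangentVec (e : OpenPartialHomeomorph M (EuclideanSpace ℝ (Fin n)))
    (x a : EuclideanSpace ℝ (Fin n)) : TangentSpace (𝓡 n) (e.symm x) :=
  mfderiv (𝓡 n) (𝓡 n) e.symm x a

/-- The chart `(x^i, u^i)` of the tangent bundle induced by a chart `e` of `M`. -/
def tangentChart (e : OpenPartialHomeomorph M (EuclideanSpace ℝ (Fin n)))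
    (v : TangentBundle (𝓡 n) M) : EuclideanSpace ℝ (Fin n ⊕ Fin n) :=
  pair (e v.proj) (mfderiv (𝓡 n) (𝓡 n) e v.proj v.snd)

/-- The components `ξ^i` of a vector field in the chart `e`. -/
def vectorComp (ξ : ∀ p : M, TangentSpace (𝓡 n) p)
    (e : OpenPartialHomeomorph M (EuclideanSpace ℝ (Fin n))) (x : EuclideanSpace ℝ (Fin n)) :
    EuclideanSpace ℝ (Fin n) :=
  mfderiv (𝓡 n) (𝓡 n) e (e.symm x) (ξ (e.symm x))

/-- The coordinate expression of the map `ξ : M → TM` in the chart `e` and the induced chart. -/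
def sectionComp (ξ : ∀ p : M, TangentSpace (𝓡 n) p)
    (e : OpenPartialHomeomorph M (EuclideanSpace ℝ (Fin n))) (x : EuclideanSpace ℝ (Fin n)) :
    EuclideanSpace ℝ (Fin n ⊕ Fin n) :=
  tangentChart e ⟨e.symm x, ξ (e.symm x)⟩

/-- The components `φ_i^h` (row `h`, column `i`) of a field of endomorphisms in the chart `e`. -/
def endoComp (φ : ∀ p : M, TangentSpace (𝓡 n) p →L[ℝ] TangentSpace (𝓡 n) p)
    (e : OpenPartialHomeomorph M (EuclideanSpace ℝ (Fin n))) (x : EuclideanSpace ℝ (Fin n)) :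
    Matrix (Fin n) (Fin n) ℝ :=
  Matrix.of fun h i =>
    (show EuclideanSpace ℝ (Fin n) from mfderiv (𝓡 n) (𝓡 n) e (e.symm x)
      (φ (e.symm x) (tangentVec e x (EuclideanSpace.single i 1)))) h

variable [IsManifold (𝓡 n) ∞ M]

/-- Smooth Riemannian metrics on `M`. -/
abbrev Metric (n : ℕ) (M : Type*) [TopologicalSpace M]
    [ChartedSpace (EuclideanSpace ℝ (Fin n)) M] [IsManifold (𝓡 n) ∞ M] :=
  Bundle.ContMDiffRiemannianMetric (𝓡 n) ∞ (EuclideanSpace ℝ (Fin n))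
    (fun p : M => TangentSpace (𝓡 n) p)

/-- The components `g_{ij}` of the metric in the chart `e`. -/
def metricComp (g : Metric n M) (e : OpenPartialHomeomorph M (EuclideanSpace ℝ (Fin n)))
    (x : EuclideanSpace ℝ (Fin n)) : Matrix (Fin n) (Fin n) ℝ :=
  Matrix.of fun i j => g.inner (e.symm x) (tangentVec e x (EuclideanSpace.single i 1))
    (tangentVec e x (EuclideanSpace.single j 1))

/-- `(M, φ, g)` is an anti-paraKähler manifold: `φ` is a smooth almost paracomplex structure,
`g` is an anti-paraHermitian metric, and `φ` is parallel for the Levi-Civita connection. -/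
structure IsAntiParaKahler (g : Metric n M)
    (φ : ∀ p : M, TangentSpace (𝓡 n) p →L[ℝ] TangentSpace (𝓡 n) p) : Prop where
  smooth : ContMDiff (𝓡 n)
    ((𝓡 n).prod 𝓘(ℝ, EuclideanSpace ℝ (Fin n) →L[ℝ] EuclideanSpace ℝ (Fin n))) ∞
    (fun p : M => Bundle.TotalSpace.mk'
      (EuclideanSpace ℝ (Fin n) →L[ℝ] EuclideanSpace ℝ (Fin n))
      (E := fun p : M => TangentSpace (𝓡 n) p →L[ℝ] TangentSpace (𝓡 n) p) p (φ p))
  involutive : ∀ (p : M) (X : TangentSpace (𝓡 n) p), φ p (φ p X) = X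
  /-- The eigenbundles for the eigenvalues `1` and `-1` have the same rank. -/
  rank_eq : ∀ p : M,
    Module.finrank ℝ (Module.End.eigenspace (φ p).toLinearMap (1 : ℝ))
      = Module.finrank ℝ (Module.End.eigenspace (φ p).toLinearMap (-1 : ℝ))
  isometry : ∀ (p : M) (X Y : TangentSpace (𝓡 n) p),
    g.inner p (φ p X) (φ p Y) = g.inner p X Y
  /-- `∇φ = 0`, expressed in every chart. -/
  parallel : ∀ e ∈ IsManifold.maximalAtlas (𝓡 n) ∞ M, ∀ x ∈ e.target, ∀ k i h : Fin n,
    covDerivEndo (metricComp g e) (endoComp φ e) x k i h = 0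

/-- The Berger type deformed Sasaki metric `g_BS` over the domain of the chart `e`, evaluated at the
point of `TM` with induced coordinates `z = (x, u)` on two tangent vectors with components `a`, `b`
in the frame `(∂/∂x^i, ∂/∂u^i)`. -/
def bergerSasaki (g : Metric n M)
    (φ : ∀ p : M, TangentSpace (𝓡 n) p →L[ℝ] TangentSpace (𝓡 n) p) (δ : ℝ)
    (e : OpenPartialHomeomorph M (EuclideanSpace ℝ (Fin n)))
    (z a b : EuclideanSpace ℝ (Fin n ⊕ Fin n)) : ℝ :=
  g.inner (e.symm (base z)) (tangentVec e (base z) (base a)) (tangentVec e (base z) (base b))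
    + g.inner (e.symm (base z)) (tangentVec e (base z) (connector (metricComp g e) z a))
        (tangentVec e (base z) (connector (metricComp g e) z b))
    + δ ^ 2
      * g.inner (e.symm (base z)) (tangentVec e (base z) (connector (metricComp g e) z a))
          (φ (e.symm (base z)) (tangentVec e (base z) (fibre z)))
      * g.inner (e.symm (base z)) (tangentVec e (base z) (connector (metricComp g e) z b))
          (φ (e.symm (base z)) (tangentVec e (base z) (fibre z)))

/-- The component matrix of `g_BS` in the frame `(∂/∂x^i, ∂/∂u^i)` of the induced chart. -/
def bergerSasakiComp (g : Metric n M)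
    (φ : ∀ p : M, TangentSpace (𝓡 n) p →L[ℝ] TangentSpace (𝓡 n) p) (δ : ℝ)
    (e : OpenPartialHomeomorph M (EuclideanSpace ℝ (Fin n)))
    (z : EuclideanSpace ℝ (Fin n ⊕ Fin n)) : Matrix (Fin n ⊕ Fin n) (Fin n ⊕ Fin n) ℝ :=
  Matrix.of fun α β =>
    bergerSasaki g φ δ e z (EuclideanSpace.single α 1) (EuclideanSpace.single β 1)

/-- `A_{mn}^h = δ² / (1 + δ² g_{00}) φ_n^k φ_0^h g_{mk}` along the vector field `ξ`, where
`g_{00} = g_{kl} ξ^k ξ^l` and `φ_0^h = φ_l^h ξ^l`. -/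
def tensorA (g : Metric n M)
    (φ : ∀ p : M, TangentSpace (𝓡 n) p →L[ℝ] TangentSpace (𝓡 n) p) (δ : ℝ)
    (ξ : ∀ p : M, TangentSpace (𝓡 n) p)
    (e : OpenPartialHomeomorph M (EuclideanSpace ℝ (Fin n))) (x : EuclideanSpace ℝ (Fin n))
    (m j h : Fin n) : ℝ :=
  δ ^ 2 / (1 + δ ^ 2 * ∑ k, ∑ l, metricComp g e x k l * vectorComp ξ e x k * vectorComp ξ e x l)
    * ∑ k, endoComp φ e x k j * (∑ l, endoComp φ e x h l * vectorComp ξ e x l)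
        * metricComp g e x m k

/-- The second fundamental form `β(ξ)(∂/∂x^i, ∂/∂x^j)` of `ξ : (M, g) → (TM, g_BS)` at the point
with coordinates `x`, as the vector of its components in the frame `(∂/∂x^i, ∂/∂u^i)`. -/
def betaField (g : Metric n M)
    (φ : ∀ p : M, TangentSpace (𝓡 n) p →L[ℝ] TangentSpace (𝓡 n) p) (δ : ℝ)
    (ξ : ∀ p : M, TangentSpace (𝓡 n) p)
    (e : OpenPartialHomeomorph M (EuclideanSpace ℝ (Fin n))) (x : EuclideanSpace ℝ (Fin n))
    (i j : Fin n) : EuclideanSpace ℝ (Fin n ⊕ Fin n) :=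
  WithLp.toLp 2 (secondFundamentalForm (metricComp g e) (bergerSasakiComp g φ δ e)
    (sectionComp ξ e) x i j)

/-- The tension field `τ(ξ)` of `ξ : (M, g) → (TM, g_BS)` at the point with coordinates `x`, as the
vector of its components in the frame `(∂/∂x^i, ∂/∂u^i)`. -/
def tauField (g : Metric n M)
    (φ : ∀ p : M, TangentSpace (𝓡 n) p →L[ℝ] TangentSpace (𝓡 n) p) (δ : ℝ)
    (ξ : ∀ p : M, TangentSpace (𝓡 n) p)
    (e : OpenPartialHomeomorph M (EuclideanSpace ℝ (Fin n))) (x : EuclideanSpace ℝ (Fin n)) :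
    EuclideanSpace ℝ (Fin n ⊕ Fin n) :=
  WithLp.toLp 2 (tensionField (metricComp g e) (bergerSasakiComp g φ δ e) (sectionComp ξ e) x)

/-- The defining properties of `g_BS` on horizontal and vertical lifts. -/
lemma bergerSasaki_lifts (g : Metric n M)
    (φ : ∀ p : M, TangentSpace (𝓡 n) p →L[ℝ] TangentSpace (𝓡 n) p) (δ : ℝ)
    (e : OpenPartialHomeomorph M (EuclideanSpace ℝ (Fin n)))
    (z : EuclideanSpace ℝ (Fin n ⊕ Fin n)) (a b : EuclideanSpace ℝ (Fin n)) :
    bergerSasaki g φ δ e z (horizontalLift (metricComp g e) z a)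
        (horizontalLift (metricComp g e) z b)
      = g.inner (e.symm (base z)) (tangentVec e (base z) a) (tangentVec e (base z) b)
    ∧ bergerSasaki g φ δ e z (verticalLift a) (horizontalLift (metricComp g e) z b) = 0
    ∧ bergerSasaki g φ δ e z (horizontalLift (metricComp g e) z a) (verticalLift b) = 0
    ∧ bergerSasaki g φ δ e z (verticalLift a) (verticalLift b)
      = g.inner (e.symm (base z)) (tangentVec e (base z) a) (tangentVec e (base z) b)
        + δ ^ 2
          * g.inner (e.symm (base z)) (tangentVec e (base z) a)
              (φ (e.symm (base z)) (tangentVec e (base z) (fibre z)))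
          * g.inner (e.symm (base z)) (tangentVec e (base z) b)
              (φ (e.symm (base z)) (tangentVec e (base z) (fibre z))) := by
  have h0 : ∀ x, tangentVec e x (0 : EuclideanSpace ℝ (Fin n)) = 0 := fun x => map_zero _
  simp [bergerSasaki, h0]

end Manifold

end BergerSasaki

end

noncomputable section

namespace BergerSasaki

/-! ### Regularity of chart components on the manifold. -/

section ChartRegularity

variable {n : ℕ} {M : Type*} [TopologicalSpace M] [ChartedSpace (EuclideanSpace ℝ (Fin n)) M]

/-! The Christoffel symbols of the metric on `TM` are found without inverting its matrix: a vector
with prescribed horizontal and vertical parts is shown to satisfy the Koszul identity, and positive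
definiteness makes such a vector unique.

Write `u` for the fibre point, `K a` for the vertical part of `a`, and `N(c, a)` for the covariant
derivative of `K a` in the direction `c` (`verticalPartDeriv`). Because `G` and `P` are parallel,
differentiating the metric produces only `N` and `P (K c)`, the covariant derivative of `P u`
(`fderiv_deformedSasaki`). The antisymmetric part of `N` is the curvature: `N(a, b) - N(b, a) =
R(πa, πb)u`. In the Koszul expression this leaves the curvature pairings that define the horizontal
vector `W`, together with `½(N(a, b) + N(b, a))` in the vertical direction.

The deformation contributes little, for two reasons. First, `P` is an isometric involution, hence
self-adjoint; its cross terms cancel and only `2δ² G(K a, P K b) G(K l, P u)` survives. The deformed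
form of `P u` with `K l` is `(1 + δ² G(u, u)) G(P u, K l)`, which explains the denominator of `A`.
Second, `R` is skew (`curvatureVec_skew`) and commutes with `P` (`curvatureVec_comm`), so `G(R u, P
u) = 0` and the curvature terms are those of the undeformed metric. This is
`deformedSasaki_eq_half_koszul`, turned into Christoffel symbols by
`IsAntiParaKahlerCoord.bilinOf_christoffel_eq`.

For a section `x ↦ (x, V x)` with derivatives `f i`, one has `K (f i) = ∇_i V`, and `∇_i∇_j V` is
the second partial derivative plus `N(f i, f j)`, minus the `Γ^k_{ij} ∇_k V` term (`covDeriv₂_eq`).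
Replacing `N(f i, f j)` by its symmetric average costs `½ R(∂_i, ∂_j)V`, which gives `β` in
`secondFundamentalForm_section_eq`. Tracing with the symmetric `g^{ij}` kills the curvature term and
merges the two horizontal ones. -/

lemma mdifferentiable_of_mem_maximalAtlas
    {e : OpenPartialHomeomorph M (EuclideanSpace ℝ (Fin n))}
    (he : e ∈ IsManifold.maximalAtlas (𝓡 n) ∞ M) : e.MDifferentiable (𝓡 n) (𝓡 n) :=
  ⟨(contMDiffOn_of_mem_maximalAtlas he).mdifferentiableOn (by simp),
    (contMDiffOn_symm_of_mem_maximalAtlas he).mdifferentiableOn (by simp)⟩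

lemma mfderiv_tangentVec {e : OpenPartialHomeomorph M (EuclideanSpace ℝ (Fin n))}
    (he : e ∈ IsManifold.maximalAtlas (𝓡 n) ∞ M) {x : EuclideanSpace ℝ (Fin n)}
    (hx : x ∈ e.target) (a : EuclideanSpace ℝ (Fin n)) :
    mfderiv (𝓡 n) (𝓡 n) e (e.symm x) (tangentVec e x a) = a :=
  DFunLike.congr_fun ((mdifferentiable_of_mem_maximalAtlas he).comp_symm_deriv hx) a

lemma tangentVec_mfderiv {e : OpenPartialHomeomorph M (EuclideanSpace ℝ (Fin n))}
    (he : e ∈ IsManifold.maximalAtlas (𝓡 n) ∞ M) {x : EuclideanSpace ℝ (Fin n)}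
    (hx : x ∈ e.target) (X : TangentSpace (𝓡 n) (e.symm x)) :
    tangentVec e x (mfderiv (𝓡 n) (𝓡 n) e (e.symm x) X) = X := by
  have h := DFunLike.congr_fun
    ((mdifferentiable_of_mem_maximalAtlas he).symm_comp_deriv (e.map_target hx)) X
  rw [e.right_inv hx] at h
  exact h

variable [IsManifold (𝓡 n) ∞ M]

/-- A coordinate field is the image of a constant section under the tangent map of `e.symm`. -/
lemma contMDiffOn_tangentVec {e : OpenPartialHomeomorph M (EuclideanSpace ℝ (Fin n))}
    (he : e ∈ IsManifold.maximalAtlas (𝓡 n) ∞ M) (a : EuclideanSpace ℝ (Fin n)) :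
    ContMDiffOn (𝓡 n) (𝓡 n).tangent ∞
      (fun x => (⟨e.symm x, tangentVec e x a⟩ : TangentBundle (𝓡 n) M)) e.target := by
  have h1 := (contMDiffOn_symm_of_mem_maximalAtlas he).contMDiffOn_tangentMapWithin
    (m := ∞) (by simp) e.open_target.uniqueMDiffOn
  have h2 : ContMDiffOn (𝓡 n) (𝓡 n).tangent ∞
      (fun x => (⟨x, a⟩ : TangentBundle (𝓡 n) (EuclideanSpace ℝ (Fin n)))) e.target :=
    contMDiffOn_vectorSpace_iff_contDiffOn.2 contDiffOn_const
  refine (h1.comp h2 fun x hx => hx).congr fun x hx => ?_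
  simp [tangentMapWithin, tangentVec, mfderivWithin_of_isOpen e.open_target hx]

/-- The components are the fibre part of the tangent map of `e` composed with the section. This
serves both vector fields and endomorphisms applied to coordinate fields. -/
lemma contDiffOn_mfderiv_comp {e : OpenPartialHomeomorph M (EuclideanSpace ℝ (Fin n))}
    (he : e ∈ IsManifold.maximalAtlas (𝓡 n) ∞ M)
    {v : ∀ x : EuclideanSpace ℝ (Fin n), TangentSpace (𝓡 n) (e.symm x)}
    (hv : ContMDiffOn (𝓡 n) (𝓡 n).tangent ∞
      (fun x => (⟨e.symm x, v x⟩ : TangentBundle (𝓡 n) M)) e.target) :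
    ContDiffOn ℝ ∞ (fun x => (mfderiv (𝓡 n) (𝓡 n) e (e.symm x) (v x) :
      EuclideanSpace ℝ (Fin n))) e.target := by
  have h1 := (contMDiffOn_of_mem_maximalAtlas he).contMDiffOn_tangentMapWithin
    (m := ∞) (by simp) e.open_source.uniqueMDiffOn
  have h2 := h1.comp hv fun x hx => e.map_target hx
  refine (((contMDiff_snd_tangentBundle_modelSpace _ (𝓡 n)).comp_contMDiffOn h2).contDiffOn).congr
    fun x hx => ?_
  change _ = mfderivWithin (𝓡 n) (𝓡 n) e e.source (e.symm x) (v x)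
  rw [mfderivWithin_of_isOpen e.open_source (e.map_target hx)]

lemma contDiffOn_vectorComp {e : OpenPartialHomeomorph M (EuclideanSpace ℝ (Fin n))}
    (he : e ∈ IsManifold.maximalAtlas (𝓡 n) ∞ M) {ξ : ∀ p : M, TangentSpace (𝓡 n) p}
    (hξ : ContMDiff (𝓡 n) (𝓡 n).tangent ∞ (fun p : M => (⟨p, ξ p⟩ : TangentBundle (𝓡 n) M))) :
    ContDiffOn ℝ ∞ (vectorComp ξ e) e.target :=
  contDiffOn_mfderiv_comp he
    (hξ.comp_contMDiffOn (contMDiffOn_symm_of_mem_maximalAtlas he))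

lemma contDiffOn_endoComp {e : OpenPartialHomeomorph M (EuclideanSpace ℝ (Fin n))}
    (he : e ∈ IsManifold.maximalAtlas (𝓡 n) ∞ M)
    {φ : ∀ p : M, TangentSpace (𝓡 n) p →L[ℝ] TangentSpace (𝓡 n) p}
    (hφ : ContMDiff (𝓡 n)
      ((𝓡 n).prod 𝓘(ℝ, EuclideanSpace ℝ (Fin n) →L[ℝ] EuclideanSpace ℝ (Fin n))) ∞
      (fun p : M => Bundle.TotalSpace.mk'
        (EuclideanSpace ℝ (Fin n) →L[ℝ] EuclideanSpace ℝ (Fin n))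
        (E := fun p : M => TangentSpace (𝓡 n) p →L[ℝ] TangentSpace (𝓡 n) p) p (φ p)))
    (h i : Fin n) : ContDiffOn ℝ ∞ (fun x => endoComp φ e x h i) e.target := by
  have h1 := contDiffOn_mfderiv_comp he (ContMDiffOn.clm_bundle_apply
    (hφ.comp_contMDiffOn (contMDiffOn_symm_of_mem_maximalAtlas he))
    (contMDiffOn_tangentVec he (EuclideanSpace.single i 1)))
  exact (contDiffOn_euclidean.1 h1) h

lemma contDiffOn_metricComp {e : OpenPartialHomeomorph M (EuclideanSpace ℝ (Fin n))}
    (he : e ∈ IsManifold.maximalAtlas (𝓡 n) ∞ M) (g : Metric n M) (i j : Fin n) :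
    ContDiffOn ℝ ∞ (fun x => metricComp g e x i j) e.target := by
  have h1 : ContMDiffOn (𝓡 n) ((𝓡 n).prod 𝓘(ℝ)) ∞ (fun x => Bundle.TotalSpace.mk' ℝ
      (E := Bundle.Trivial M ℝ) (e.symm x) (g.inner (e.symm x)
        (tangentVec e x (EuclideanSpace.single i 1)) (tangentVec e x (EuclideanSpace.single j 1))))
      e.target :=
    ContMDiffOn.clm_bundle_apply₂ (F₁ := EuclideanSpace ℝ (Fin n))
      (F₂ := EuclideanSpace ℝ (Fin n))
      (g.contMDiff.comp_contMDiffOn (contMDiffOn_symm_of_mem_maximalAtlas he))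
      (contMDiffOn_tangentVec he _) (contMDiffOn_tangentVec he _)
  intro x hx
  have h2 := (Bundle.contMDiffWithinAt_totalSpace.1 (h1 x hx)).2
  exact h2.contDiffWithinAt

end ChartRegularity

/-! ### Curvature identities forced by parallel tensors. -/

section ParallelTensors

open Filter Topology

variable {E : Type*} [NormedAddCommGroup E] [NormedSpace ℝ E]

/-- The curvature operator `R(a, b)u` of the connection `∇_a u = D_a u + Γ(a, u)`. -/
def curvatureVec (Γ : E → E →L[ℝ] E →L[ℝ] E) (x a b u : E) : E :=
  fderiv ℝ Γ x a b u - fderiv ℝ Γ x b a u + Γ x a (Γ x b u) - Γ x b (Γ x a u)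

/-- The form `G` is parallel at `x` for the connection `Γ`. -/
def FormParallelAt (G : E → E →L[ℝ] E →L[ℝ] ℝ) (Γ : E → E →L[ℝ] E →L[ℝ] E) (x : E) : Prop :=
  ∀ c X Y, fderiv ℝ G x c X Y = G x (Γ x c X) Y + G x X (Γ x c Y)

/-- The endomorphism field `P` is parallel at `x` for the connection `Γ`. -/
def EndoParallelAt (P : E → E →L[ℝ] E) (Γ : E → E →L[ℝ] E →L[ℝ] E) (x : E) : Prop :=
  ∀ c X, fderiv ℝ P x c X = P x (Γ x c X) - Γ x c (P x X)

variable {G : E → E →L[ℝ] E →L[ℝ] ℝ} {Γ : E → E →L[ℝ] E →L[ℝ] E} {P : E → E →L[ℝ] E} {x : E}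

lemma fderiv_clm_apply_const {F H : Type*} [NormedAddCommGroup F] [NormedSpace ℝ F]
    [NormedAddCommGroup H] [NormedSpace ℝ H] {T : E → F →L[ℝ] H} (hT : ContDiffAt ℝ 1 T x)
    (X : F) (c : E) : fderiv ℝ (fun y => T y X) x c = fderiv ℝ T x c X := by
  rw [((hT.differentiableAt (by simp)).hasFDerivAt.clm_apply (hasFDerivAt_const X x)).fderiv]
  simp

lemma fderiv_clm_apply₂_const {F H K : Type*} [NormedAddCommGroup F] [NormedSpace ℝ F]
    [NormedAddCommGroup H] [NormedSpace ℝ H] [NormedAddCommGroup K] [NormedSpace ℝ K]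
    {T : E → F →L[ℝ] H →L[ℝ] K} (hT : ContDiffAt ℝ 1 T x) (X : F) (Y : H) (c : E) :
    fderiv ℝ (fun y => T y X Y) x c = fderiv ℝ T x c X Y := by
  rw [fderiv_clm_apply_const (hT.clm_apply contDiffAt_const), fderiv_clm_apply_const hT]

lemma formParallelAt_iff (hG : ContDiffAt ℝ 1 G x) : FormParallelAt G Γ x ↔
    ∀ c X Y, fderiv ℝ (fun y => G y X Y) x c = G x (Γ x c X) Y + G x X (Γ x c Y) := by
  simp only [FormParallelAt, fderiv_clm_apply₂_const hG]

lemma endoParallelAt_iff (hP : ContDiffAt ℝ 1 P x) : EndoParallelAt P Γ x ↔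
    ∀ c X, fderiv ℝ (fun y => P y X) x c = P x (Γ x c X) - Γ x c (P x X) := by
  simp only [EndoParallelAt, fderiv_clm_apply_const hP]

lemma curvatureVec_eq (hΓ : ContDiffAt ℝ 1 Γ x) (a b u : E) :
    curvatureVec Γ x a b u = fderiv ℝ (fun y => Γ y b u) x a - fderiv ℝ (fun y => Γ y a u) x b
      + Γ x a (Γ x b u) - Γ x b (Γ x a u) := by
  simp only [curvatureVec, fderiv_clm_apply₂_const hΓ]

lemma fderiv_fderiv_apply_comm {F : Type*} [NormedAddCommGroup F] [NormedSpace ℝ F] {f : E → F}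
    (hf : ContDiffAt ℝ 2 f x) (c d : E) :
    fderiv ℝ (fun y => fderiv ℝ f y c) x d = fderiv ℝ (fun y => fderiv ℝ f y d) x c := by
  have h1 : DifferentiableAt ℝ (fderiv ℝ f) x :=
    (hf.fderiv_right (m := 1) (by norm_num)).differentiableAt (by simp)
  have h2 : ∀ v w, fderiv ℝ (fun y => fderiv ℝ f y v) x w = fderiv ℝ (fderiv ℝ f) x w v := by
    intro v w
    rw [fderiv_clm_apply h1 (differentiableAt_const v)]
    simp
  rw [h2, h2]
  exact hf.isSymmSndFDerivAt (by simp) d c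

/-- Differentiate the parallelism equation once more and antisymmetrise: second derivatives of `G(X,
Y)` commute, and what remains is the curvature acting on both slots. Parallelism is needed near `x`
because it gets differentiated. -/
lemma curvatureVec_skew (hG : ContDiffAt ℝ 2 G x) (hΓ : DifferentiableAt ℝ Γ x)
    (h : ∀ᶠ y in 𝓝 x, FormParallelAt G Γ y) (a b X Y : E) :
    G x (curvatureVec Γ x a b X) Y = -G x X (curvatureVec Γ x a b Y) := by
  have hG1 : DifferentiableAt ℝ G x := hG.differentiableAt (by simp)
  have hd : ∀ᶠ y in 𝓝 x, DifferentiableAt ℝ G y :=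
    (hG.eventually (by simp)).mono fun y hy => hy.differentiableAt (by simp)
  have key : ∀ c d, fderiv ℝ (fun y => fderiv ℝ (fun w => G w X Y) y c) x d
      = G x (Γ x d (Γ x c X)) Y + G x (Γ x c X) (Γ x d Y) + G x (fderiv ℝ Γ x d c X) Y
        + (G x (Γ x d X) (Γ x c Y) + G x X (Γ x d (Γ x c Y)) + G x X (fderiv ℝ Γ x d c Y)) := by
    intro c d
    have h1 : (fun y => fderiv ℝ (fun w => G w X Y) y c)
        =ᶠ[𝓝 x] fun y => G y (Γ y c X) Y + G y X (Γ y c Y) := by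
      filter_upwards [h, hd] with y hy hdy
      rw [← hy, ((hdy.hasFDerivAt.clm_apply (hasFDerivAt_const X y)).clm_apply
        (hasFDerivAt_const Y y)).fderiv]
      simp
    have hc : ∀ Z, HasFDerivAt (fun y => Γ y c Z) _ x := fun Z =>
      (hΓ.hasFDerivAt.clm_apply (hasFDerivAt_const c x)).clm_apply (hasFDerivAt_const Z x)
    rw [h1.fderiv_eq, (((hG1.hasFDerivAt.clm_apply (hc X)).clm_apply (hasFDerivAt_const Y x)).fun_add
      ((hG1.hasFDerivAt.clm_apply (hasFDerivAt_const X x)).clm_apply (hc Y))).fderiv]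
    have h0 := h.self_of_nhds
    simp [h0 d]
    ring
  have hs := fderiv_fderiv_apply_comm (f := fun w => G w X Y)
    ((hG.clm_apply contDiffAt_const).clm_apply contDiffAt_const) a b
  rw [key, key] at hs
  simp only [curvatureVec, map_add, map_sub, add_apply,
    sub_apply]
  linarith

/-- The same argument, with the commuting second derivatives of `P X`. -/
lemma curvatureVec_comm (hP : ContDiffAt ℝ 2 P x) (hΓ : DifferentiableAt ℝ Γ x)
    (h : ∀ᶠ y in 𝓝 x, EndoParallelAt P Γ y) (a b X : E) :
    curvatureVec Γ x a b (P x X) = P x (curvatureVec Γ x a b X) := by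
  have hP1 : DifferentiableAt ℝ P x := hP.differentiableAt (by simp)
  have hd : ∀ᶠ y in 𝓝 x, DifferentiableAt ℝ P y :=
    (hP.eventually (by simp)).mono fun y hy => hy.differentiableAt (by simp)
  have key : ∀ c d, fderiv ℝ (fun y => fderiv ℝ (fun w => P w X) y c) x d
      = P x (Γ x d (Γ x c X)) - Γ x d (P x (Γ x c X)) + P x (fderiv ℝ Γ x d c X)
        - (fderiv ℝ Γ x d c (P x X) + Γ x c (P x (Γ x d X)) - Γ x c (Γ x d (P x X))) := by
    intro c d
    have h1 : (fun y => fderiv ℝ (fun w => P w X) y c)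
        =ᶠ[𝓝 x] fun y => P y (Γ y c X) - Γ y c (P y X) := by
      filter_upwards [h, hd] with y hy hdy
      rw [← hy, (hdy.hasFDerivAt.clm_apply (hasFDerivAt_const X y)).fderiv]
      simp
    have hc := hΓ.hasFDerivAt.clm_apply (hasFDerivAt_const c x)
    rw [h1.fderiv_eq, ((hP1.hasFDerivAt.clm_apply (hc.clm_apply (hasFDerivAt_const X x))).fun_sub
      (hc.clm_apply (hP1.hasFDerivAt.clm_apply (hasFDerivAt_const X x)))).fderiv]
    have h0 := h.self_of_nhds
    simp [h0 d]
    abel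
  have hs := fderiv_fderiv_apply_comm (f := fun w => P w X) (hP.clm_apply contDiffAt_const) a b
  rw [key, key, ← sub_eq_zero] at hs
  rw [← sub_eq_zero, ← hs]
  simp only [curvatureVec, map_add, map_sub]
  abel

end ParallelTensors

/-! ### First derivatives of the deformed metric. -/

section DeformedForm

variable {E Z : Type*} [NormedAddCommGroup E] [NormedSpace ℝ E] [NormedAddCommGroup Z]
  [NormedSpace ℝ Z]

/-- The vertical component `δu(a)` of a vector `a` at `z`, where `π`, `ρ` are the projections to
the base and to the fibre. -/
def verticalPart (π ρ : Z →L[ℝ] E) (Γ : E → E →L[ℝ] E →L[ℝ] E) (z a : Z) : E :=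
  ρ a + Γ (π z) (π a) (ρ z)

/-- The covariant derivative in the direction `c` of `z ↦ verticalPart π ρ Γ z a`. -/
def verticalPartDeriv (π ρ : Z →L[ℝ] E) (Γ : E → E →L[ℝ] E →L[ℝ] E) (z c a : Z) : E :=
  fderiv ℝ Γ (π z) (π c) (π a) (ρ z) + Γ (π z) (π a) (ρ c)
    + Γ (π z) (π c) (verticalPart π ρ Γ z a)

/-- The deformed vertical form `G(X, Y) + δ² G(X, Pu) G(Y, Pu)`. -/
def deformedForm (G : E → E →L[ℝ] E →L[ℝ] ℝ) (P : E → E →L[ℝ] E) (δ : ℝ) (x u X Y : E) : ℝ :=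
  G x X Y + δ ^ 2 * G x X (P x u) * G x Y (P x u)

/-- The Berger type deformed Sasaki metric of a form `G`, a connection `Γ` and an endomorphism
field `P`. -/
def deformedSasaki (π ρ : Z →L[ℝ] E) (G : E → E →L[ℝ] E →L[ℝ] ℝ) (Γ : E → E →L[ℝ] E →L[ℝ] E)
    (P : E → E →L[ℝ] E) (δ : ℝ) (z a b : Z) : ℝ :=
  G (π z) (π a) (π b)
    + deformedForm G P δ (π z) (ρ z) (verticalPart π ρ Γ z a) (verticalPart π ρ Γ z b)

variable {π ρ : Z →L[ℝ] E} {G : E → E →L[ℝ] E →L[ℝ] ℝ} {Γ : E → E →L[ℝ] E →L[ℝ] E}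
  {P : E → E →L[ℝ] E} {δ : ℝ} {z : Z}

/-- Expanding the inner vertical part, the terms `Γ(πa)(ρb)` and `Γ(πb)(ρa)` are symmetric together
and cancel; symmetry of `Γ` plays no role. -/
lemma verticalPartDeriv_sub_comm (a b : Z) :
    verticalPartDeriv π ρ Γ z a b - verticalPartDeriv π ρ Γ z b a
      = curvatureVec Γ (π z) (π a) (π b) (ρ z) := by
  simp only [verticalPartDeriv, verticalPart, curvatureVec, map_add]
  abel

/-- Parallelism turns each derivative of `G` into `Γ` terms, and these complete the plain
derivatives of `K a` and `P u` to covariant ones. For `P u` the result is `P (K c)`, since `P`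
passes through the connection. The purely horizontal term is left as a derivative of `G`. -/
lemma fderiv_deformedSasaki (hG : DifferentiableAt ℝ G (π z)) (hΓ : DifferentiableAt ℝ Γ (π z))
    (hP : DifferentiableAt ℝ P (π z)) (hGΓ : FormParallelAt G Γ (π z))
    (hPΓ : EndoParallelAt P Γ (π z)) (a b c : Z) :
    fderiv ℝ (fun w => deformedSasaki π ρ G Γ P δ w a b) z c
      = fderiv ℝ G (π z) (π c) (π a) (π b)
        + deformedForm G P δ (π z) (ρ z) (verticalPartDeriv π ρ Γ z c a) (verticalPart π ρ Γ z b)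
        + deformedForm G P δ (π z) (ρ z) (verticalPart π ρ Γ z a) (verticalPartDeriv π ρ Γ z c b)
        + δ ^ 2 * (G (π z) (verticalPart π ρ Γ z a) (P (π z) (verticalPart π ρ Γ z c))
              * G (π z) (verticalPart π ρ Γ z b) (P (π z) (ρ z))
            + G (π z) (verticalPart π ρ Γ z a) (P (π z) (ρ z))
              * G (π z) (verticalPart π ρ Γ z b) (P (π z) (verticalPart π ρ Γ z c))) := by
  have dπ : HasFDerivAt (fun w => π w) π z := π.hasFDerivAt
  have dρ : HasFDerivAt (fun w => ρ w) ρ z := ρ.hasFDerivAt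
  have dG : HasFDerivAt (fun w => G (π w)) ((fderiv ℝ G (π z)).comp π) z :=
    HasFDerivAt.comp (g := G) z hG.hasFDerivAt dπ
  have dΓ : HasFDerivAt (fun w => Γ (π w)) ((fderiv ℝ Γ (π z)).comp π) z :=
    HasFDerivAt.comp (g := Γ) z hΓ.hasFDerivAt dπ
  have dP : HasFDerivAt (fun w => P (π w)) ((fderiv ℝ P (π z)).comp π) z :=
    HasFDerivAt.comp (g := P) z hP.hasFDerivAt dπ
  have dPu := dP.clm_apply dρ
  have dK : ∀ a, HasFDerivAt (fun w => verticalPart π ρ Γ w a) _ z := fun a =>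
    ((dΓ.clm_apply (hasFDerivAt_const (π a) z)).clm_apply dρ).const_add (ρ a)
  have e1 := ((dG.clm_apply (hasFDerivAt_const (π a) z)).clm_apply
    (hasFDerivAt_const (π b) z)).add
    ((((dG.clm_apply (dK a)).clm_apply (dK b))).add
      ((((dG.clm_apply (dK a)).clm_apply dPu).const_mul (δ ^ 2)).mul
        ((dG.clm_apply (dK b)).clm_apply dPu)))
  have e2 := congrArg (fun L => L c) e1.fderiv
  refine Eq.trans e2 ?_
  simp only [deformedForm, verticalPartDeriv]
  simp [hGΓ (π c), hPΓ (π c), -map_sub]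
  simp only [verticalPart, map_add, map_sub, add_apply]
  ring

end DeformedForm

/-! ### The Koszul identity for the deformed metric. -/

section Koszul

open Filter Topology

variable {E Z : Type*} [NormedAddCommGroup E] [NormedSpace ℝ E] [NormedAddCommGroup Z]
  [NormedSpace ℝ Z]

/-- The Koszul expression `D_a S(b, l) + D_b S(a, l) - D_l S(a, b)` for constant vectors. -/
def koszul (S : Z → Z → Z → ℝ) (z a b l : Z) : ℝ :=
  fderiv ℝ (fun w => S w b l) z a + fderiv ℝ (fun w => S w a l) z b
    - fderiv ℝ (fun w => S w a b) z l

variable {π ρ : Z →L[ℝ] E} {G : E → E →L[ℝ] E →L[ℝ] ℝ} {Γ : E → E →L[ℝ] E →L[ℝ] E}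
  {P : E → E →L[ℝ] E} {δ : ℝ} {z : Z}

lemma differentiableAt_deformedSasaki (hG : ContDiffAt ℝ 1 G (π z))
    (hΓ : ContDiffAt ℝ 1 Γ (π z)) (hP : ContDiffAt ℝ 1 P (π z)) (a b : Z) :
    DifferentiableAt ℝ (fun w => deformedSasaki π ρ G Γ P δ w a b) z := by
  have dG : DifferentiableAt ℝ (fun w => G (π w)) z :=
    DifferentiableAt.comp (g := G) z (hG.differentiableAt (by simp)) π.differentiableAt
  have dΓ : DifferentiableAt ℝ (fun w => Γ (π w)) z :=
    DifferentiableAt.comp (g := Γ) z (hΓ.differentiableAt (by simp)) π.differentiableAt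
  have dP : DifferentiableAt ℝ (fun w => P (π w)) z :=
    DifferentiableAt.comp (g := P) z (hP.differentiableAt (by simp)) π.differentiableAt
  have dPu := dP.clm_apply ρ.differentiableAt
  have dK : ∀ a, DifferentiableAt ℝ (fun w => verticalPart π ρ Γ w a) z := fun a =>
    ((dΓ.clm_apply (differentiableAt_const (π a))).clm_apply ρ.differentiableAt).const_add (ρ a)
  exact ((dG.clm_apply (differentiableAt_const (π a))).clm_apply
    (differentiableAt_const (π b))).fun_add
    ((((dG.clm_apply (dK a)).clm_apply (dK b))).fun_add
      ((((dG.clm_apply (dK a)).clm_apply dPu).const_mul (δ ^ 2)).fun_mul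
        ((dG.clm_apply (dK b)).clm_apply dPu)))

/-- The Levi-Civita connection of the deformed Sasaki metric: a vector `Y` with these base and
vertical components solves the Koszul equation. -/
lemma deformedSasaki_eq_half_koszul (hG : ContDiffAt ℝ 2 G (π z))
    (hΓ' : ContDiffAt ℝ 1 Γ (π z)) (hP : ContDiffAt ℝ 2 P (π z))
    (hGΓ : ∀ᶠ y in 𝓝 (π z), FormParallelAt G Γ y) (hPΓ : ∀ᶠ y in 𝓝 (π z), EndoParallelAt P Γ y)
    (hGs : ∀ X Y, G (π z) X Y = G (π z) Y X) (hΓs : ∀ X Y, Γ (π z) X Y = Γ (π z) Y X)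
    (hPP : ∀ X, P (π z) (P (π z) X) = X)
    (hGP : ∀ X Y, G (π z) (P (π z) X) (P (π z) Y) = G (π z) X Y)
    (hpos : 0 ≤ G (π z) (ρ z) (ρ z)) {a b Y : Z} {W : E}
    (hW : ∀ X, G (π z) W X
      = G (π z) (verticalPart π ρ Γ z b) (curvatureVec Γ (π z) (π a) X (ρ z))
        + G (π z) (verticalPart π ρ Γ z a) (curvatureVec Γ (π z) (π b) X (ρ z)))
    (hπ : π Y = Γ (π z) (π a) (π b) + (1 / 2 : ℝ) • W)
    (hK : verticalPart π ρ Γ z Y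
      = (1 / 2 : ℝ) • (verticalPartDeriv π ρ Γ z a b + verticalPartDeriv π ρ Γ z b a)
        + (δ ^ 2 / (1 + δ ^ 2 * G (π z) (ρ z) (ρ z))
          * G (π z) (verticalPart π ρ Γ z a) (P (π z) (verticalPart π ρ Γ z b)))
          • P (π z) (ρ z)) (l : Z) :
    deformedSasaki π ρ G Γ P δ z Y l = (1 / 2) * koszul (deformedSasaki π ρ G Γ P δ) z a b l := by
  have hΓ : DifferentiableAt ℝ Γ (π z) := hΓ'.differentiableAt (by simp)
  have hGx := hGΓ.self_of_nhds
  have hPx := hPΓ.self_of_nhds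
  -- An isometric involution is self-adjoint.
  have hsym : ∀ X Y, G (π z) (P (π z) X) Y = G (π z) X (P (π z) Y) := fun X Y => by
    rw [← hGP X (P (π z) Y), hPP]
  -- `G(Ru, Pu) = -G(u, RPu) = -G(u, PRu) = -G(Ru, Pu)`: the deformation does not see the curvature.
  have hRP : ∀ c d, G (π z) (curvatureVec Γ (π z) c d (ρ z)) (P (π z) (ρ z)) = 0 := by
    intro c d
    have h1 := curvatureVec_skew hG hΓ hGΓ c d (ρ z) (P (π z) (ρ z))
    rw [curvatureVec_comm hP hΓ hPΓ, hGs (ρ z), hsym] at h1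
    linarith
  -- Used to trade `N(a, l)` and `N(b, l)` for `N(l, a)` and `N(l, b)`, which cancel against the
  -- derivative in the direction `l` and leave the curvature pairings of `hW`.
  have hN : ∀ a b, verticalPartDeriv π ρ Γ z a b
      = verticalPartDeriv π ρ Γ z b a + curvatureVec Γ (π z) (π a) (π b) (ρ z) := fun a b => by
    rw [← verticalPartDeriv_sub_comm]; abel
  simp only [koszul]
  rw [fderiv_deformedSasaki (hG.differentiableAt (by simp)) hΓ (hP.differentiableAt (by simp))
      hGx hPx,
    fderiv_deformedSasaki (hG.differentiableAt (by simp)) hΓ (hP.differentiableAt (by simp))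
      hGx hPx,
    fderiv_deformedSasaki (hG.differentiableAt (by simp)) hΓ (hP.differentiableAt (by simp))
      hGx hPx]
  simp only [hGx (π a), hGx (π b), hGx (π l), deformedSasaki, hπ, hK, hN b l, hN a l,
    deformedForm, map_add, map_smul, add_apply, smul_apply, smul_eq_mul, hW, hGP, hRP]
  -- Symmetric expressions are brought to one fixed order, so that the cancellations become
  -- polynomial identities.
  rw [hΓs (π l) (π a), hΓs (π l) (π b), hΓs (π b) (π a), hGs (Γ (π z) (π a) (π l)) (π b),
    hGs (P (π z) (ρ z)) (verticalPart π ρ Γ z l),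
    ← hsym (verticalPart π ρ Γ z b) (verticalPart π ρ Γ z a),
    hGs (P (π z) (verticalPart π ρ Γ z b)) (verticalPart π ρ Γ z a),
    ← hsym (verticalPart π ρ Γ z a) (verticalPart π ρ Γ z l),
    ← hsym (verticalPart π ρ Γ z b) (verticalPart π ρ Γ z l)]
  rw [hGs (verticalPart π ρ Γ z l) (P (π z) (verticalPart π ρ Γ z b)),
    hGs (verticalPart π ρ Γ z l) (P (π z) (verticalPart π ρ Γ z a)),
    hGs (verticalPart π ρ Γ z b) (curvatureVec Γ (π z) (π a) (π l) (ρ z)),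
    hGs (verticalPart π ρ Γ z b) (verticalPartDeriv π ρ Γ z l a)]
  have hne : 1 + δ ^ 2 * G (π z) (ρ z) (ρ z) ≠ 0 := by positivity
  field_simp
  ring

end Koszul

/-! ### Tensors from component arrays, and Christoffel symbols through the Koszul formula. -/

section CoordinateTensors

open Filter Topology

section SumSmul

variable {ι E F : Type*} [Fintype ι] [NormedAddCommGroup E] [NormedSpace ℝ E]
  [NormedAddCommGroup F] [NormedSpace ℝ F] {c : ι → E → ℝ} {x : E}

lemma contDiffAt_sum_smul {m : WithTop ℕ∞} (hc : ∀ i, ContDiffAt ℝ m (c i) x) (v : ι → F) :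
    ContDiffAt ℝ m (fun y => ∑ i, c i y • v i) x :=
  ContDiffAt.sum fun i _ => (hc i).smul contDiffAt_const

end SumSmul

variable {κ : Type*}

/-- The coordinate function `a ↦ a i`. -/
def coord (i : κ) : EuclideanSpace ℝ κ →L[ℝ] ℝ := EuclideanSpace.proj i

@[simp] lemma coord_apply (i : κ) (a : EuclideanSpace ℝ κ) : coord i a = a i := rfl

variable [Fintype κ]

/-- The bilinear form with component matrix `A`. -/
def formOf (A : Matrix κ κ ℝ) : EuclideanSpace ℝ κ →L[ℝ] EuclideanSpace ℝ κ →L[ℝ] ℝ :=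
  ∑ p : κ × κ, A p.1 p.2 • (coord p.1).smulRight (coord p.2)

lemma formOf_apply (A : Matrix κ κ ℝ) (a b : EuclideanSpace ℝ κ) :
    formOf A a b = ∑ i, ∑ j, A i j * (a i * b j) := by
  simp [formOf, Fintype.sum_prod_type]

variable {x : EuclideanSpace ℝ κ}

lemma contDiffAt_formOf {m : WithTop ℕ∞} {A : EuclideanSpace ℝ κ → Matrix κ κ ℝ}
    (hA : ∀ i j, ContDiffAt ℝ m (fun y => A y i j) x) :
    ContDiffAt ℝ m (fun y => formOf (A y)) x :=
  contDiffAt_sum_smul (c := fun (p : κ × κ) y => A y p.1 p.2) (fun p => hA p.1 p.2) _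

lemma fderiv_formOf_apply {A : EuclideanSpace ℝ κ → Matrix κ κ ℝ}
    (hA : ∀ i j, DifferentiableAt ℝ (fun y => A y i j) x) (a b c : EuclideanSpace ℝ κ) :
    fderiv ℝ (fun y => formOf (A y) a b) x c
      = formOf (Matrix.of fun i j => fderiv ℝ (fun y => A y i j) x c) a b := by
  simp only [formOf_apply]
  rw [(HasFDerivAt.fun_sum (u := Finset.univ) fun i _ => HasFDerivAt.fun_sum (u := Finset.univ)
    fun j _ => (hA i j).hasFDerivAt.mul_const (a i * b j)).fderiv]
  simp [mul_comm]

lemma formOf_comm {A : Matrix κ κ ℝ} (hA : ∀ i j, A i j = A j i) (a b : EuclideanSpace ℝ κ) :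
    formOf A a b = formOf A b a := by
  rw [formOf_apply, formOf_apply, Finset.sum_comm]
  refine Finset.sum_congr rfl fun i _ => Finset.sum_congr rfl fun j _ => ?_
  rw [hA]
  ring

lemma contDiffAt_det {ι : Type*} [Fintype ι] [DecidableEq ι] {m : WithTop ℕ∞}
    {A : EuclideanSpace ℝ κ → Matrix ι ι ℝ}
    (hA : ∀ i j, ContDiffAt ℝ m (fun y => A y i j) x) : ContDiffAt ℝ m (fun y => (A y).det) x := by
  simp only [Matrix.det_apply]
  exact ContDiffAt.sum fun σ _ => (contDiffAt_prod fun i _ => hA _ _).const_smul _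

variable [DecidableEq κ]

/-- The bilinear map with components `C h i j`, where `h` is the upper index. -/
def bilinOf (C : κ → κ → κ → ℝ) :
    EuclideanSpace ℝ κ →L[ℝ] EuclideanSpace ℝ κ →L[ℝ] EuclideanSpace ℝ κ :=
  ∑ p : κ × κ × κ, C p.1 p.2.1 p.2.2 • (coord p.2.1).smulRight
    ((coord p.2.2).smulRight (EuclideanSpace.single p.1 (1 : ℝ)))

/-- The endomorphism with component matrix `A`. -/
def endoOf (A : Matrix κ κ ℝ) : EuclideanSpace ℝ κ →L[ℝ] EuclideanSpace ℝ κ :=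
  ∑ p : κ × κ, A p.1 p.2 • (coord p.2).smulRight (EuclideanSpace.single p.1 (1 : ℝ))

lemma bilinOf_apply (C : κ → κ → κ → ℝ) (a b : EuclideanSpace ℝ κ) (h : κ) :
    bilinOf C a b h = ∑ i, ∑ j, C h i j * (a i * b j) := by
  simp [bilinOf, Fintype.sum_prod_type, Finset.sum_apply, Pi.single_apply, Finset.sum_ite_irrel]

lemma endoOf_apply (A : Matrix κ κ ℝ) (a : EuclideanSpace ℝ κ) (h : κ) :
    endoOf A a h = ∑ i, A h i * a i := by
  simp [endoOf, Fintype.sum_prod_type, Finset.sum_apply, Pi.single_apply, Finset.sum_ite_irrel]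

lemma contDiffAt_endoOf {m : WithTop ℕ∞} {A : EuclideanSpace ℝ κ → Matrix κ κ ℝ}
    (hA : ∀ i j, ContDiffAt ℝ m (fun y => A y i j) x) :
    ContDiffAt ℝ m (fun y => endoOf (A y)) x :=
  contDiffAt_sum_smul (c := fun (p : κ × κ) y => A y p.1 p.2) (fun p => hA p.1 p.2) _

lemma contDiffAt_bilinOf {m : WithTop ℕ∞} {C : EuclideanSpace ℝ κ → κ → κ → κ → ℝ}
    (hC : ∀ h i j, ContDiffAt ℝ m (fun y => C y h i j) x) :
    ContDiffAt ℝ m (fun y => bilinOf (C y)) x :=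
  contDiffAt_sum_smul (c := fun (p : κ × κ × κ) y => C y p.1 p.2.1 p.2.2)
    (fun p => hC p.1 p.2.1 p.2.2) _

lemma eq_sum_single (a : EuclideanSpace ℝ κ) :
    a = ∑ i, a i • EuclideanSpace.single i (1 : ℝ) := by
  ext j
  simp [Finset.sum_apply, Pi.single_apply]

lemma fderiv_apply_eq_sum_partialDeriv (F : EuclideanSpace ℝ κ → ℝ) (c : EuclideanSpace ℝ κ) :
    fderiv ℝ F x c = ∑ i, c i * partialDeriv i F x := by
  conv_lhs => rw [eq_sum_single c]
  simp [partialDeriv]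

/-- Bilinearity enters as four hypotheses because the Berger metric is defined as a bare function of
two vectors. -/
lemma formOf_of (B : EuclideanSpace ℝ κ → EuclideanSpace ℝ κ → ℝ)
    (add_left : ∀ a a' b, B (a + a') b = B a b + B a' b)
    (smul_left : ∀ (r : ℝ) a b, B (r • a) b = r * B a b)
    (add_right : ∀ a b b', B a (b + b') = B a b + B a b')
    (smul_right : ∀ (r : ℝ) a b, B a (r • b) = r * B a b) (a b : EuclideanSpace ℝ κ) :
    formOf (Matrix.of fun i j => B (EuclideanSpace.single i 1) (EuclideanSpace.single j 1)) a b
      = B a b := by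
  have h : B a b = LinearMap.mk₂ ℝ B add_left smul_left add_right smul_right a b := rfl
  rw [formOf_apply, h]
  conv_rhs => rw [eq_sum_single a, eq_sum_single b]
  simp only [map_sum, map_smul, LinearMap.sum_apply, LinearMap.smul_apply, LinearMap.mk₂_apply,
    smul_eq_mul, Matrix.of_apply]
  rw [Finset.sum_comm]
  refine Finset.sum_congr rfl fun i _ => ?_
  rw [Finset.mul_sum]
  exact Finset.sum_congr rfl fun j _ => by ring

lemma endoOf_of (B : EuclideanSpace ℝ κ →ₗ[ℝ] EuclideanSpace ℝ κ) (a : EuclideanSpace ℝ κ) :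
    endoOf (Matrix.of fun h i => B (EuclideanSpace.single i 1) h) a = B a := by
  ext h
  rw [endoOf_apply]
  conv_rhs => rw [eq_sum_single a]
  simp [Finset.sum_apply, mul_comm]

lemma isUnit_det_of_formOf_pos {A : Matrix κ κ ℝ} (hA : ∀ a, a ≠ 0 → 0 < formOf A a a) :
    IsUnit A.det := by
  rw [isUnit_iff_ne_zero]
  intro h0
  obtain ⟨v, hv, hAv⟩ := Matrix.exists_mulVec_eq_zero_iff.2 h0
  have h1 := hA (WithLp.toLp 2 v) (fun h => hv (by simpa using congrArg WithLp.ofLp h))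
  rw [formOf_apply] at h1
  refine h1.ne' (Finset.sum_eq_zero fun i _ => ?_)
  have h2 : ∑ j, A i j * v j = 0 := congrFun hAv i
  calc _ = v i * ∑ j, A i j * v j := by
        rw [Finset.mul_sum]; exact Finset.sum_congr rfl fun j _ => by ring
    _ = 0 := by rw [h2, mul_zero]

/-- Cramer's rule: a cofactor is the determinant of the matrix with one row replaced by a constant
one. -/
lemma contDiffAt_inv_apply {m : WithTop ℕ∞} {A : EuclideanSpace ℝ κ → Matrix κ κ ℝ}
    (hA : ∀ i j, ContDiffAt ℝ m (fun y => A y i j) x) (hu : IsUnit (A x).det) (i j : κ) :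
    ContDiffAt ℝ m (fun y => (A y)⁻¹ i j) x := by
  simp only [Matrix.inv_def, Ring.inverse_eq_inv', Matrix.smul_apply, smul_eq_mul,
    Matrix.adjugate_apply]
  refine ((contDiffAt_det hA).inv hu.ne_zero).mul (contDiffAt_det fun k l => ?_)
  by_cases hk : k = j
  · subst hk
    simpa using contDiffAt_const
  · simpa [Matrix.updateRow_ne hk] using hA k l

variable {G : EuclideanSpace ℝ κ → Matrix κ κ ℝ}

lemma christoffel_comm (hG : ∀ y i j, G y i j = G y j i) (h i j : κ) :
    christoffel G x h i j = christoffel G x h j i := by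
  simp only [christoffel, hG _ i j]
  congr 1
  exact Finset.sum_congr rfl fun l _ => by ring

lemma bilinOf_comm {C : κ → κ → κ → ℝ} (hC : ∀ h i j, C h i j = C h j i)
    (a b : EuclideanSpace ℝ κ) : bilinOf C a b = bilinOf C b a := by
  ext h
  rw [bilinOf_apply, bilinOf_apply, Finset.sum_comm]
  refine Finset.sum_congr rfl fun i _ => Finset.sum_congr rfl fun j _ => ?_
  rw [hC]
  ring

lemma contDiffAt_christoffel (hG : ∀ i j, ContDiffAt ℝ 2 (fun y => G y i j) x)
    (hu : IsUnit (G x).det) (h i j : κ) :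
    ContDiffAt ℝ 1 (fun y => christoffel G y h i j) x := by
  have hp : ∀ k i j, ContDiffAt ℝ 1 (fun y => partialDeriv k (fun w => G w i j) y) x :=
    fun k i j => ((hG i j).fderiv_right (m := 1) (by norm_num)).clm_apply contDiffAt_const
  exact contDiffAt_const.mul (ContDiffAt.sum fun l _ =>
    ((contDiffAt_inv_apply hG hu h l).of_le (by norm_num)).mul
      (((hp i j l).add (hp j i l)).sub (hp l i j)))

/-- Lowering the upper index cancels the inverse matrix in the Christoffel symbols. Applied both to
the metric on the base and to the one on the tangent bundle, where it avoids computing an inverse.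
-/
lemma formOf_christoffel (hG : ∀ i j, DifferentiableAt ℝ (fun y => G y i j) x)
    (hs : ∀ i j, G x i j = G x j i)
    (hu : IsUnit (G x).det) (a b l : EuclideanSpace ℝ κ) :
    formOf (G x) (bilinOf (christoffel G x) a b) l
      = (1 / 2) * koszul (fun y a b => formOf (G y) a b) x a b l := by
  have hf : ∀ a b c, fderiv ℝ (fun y => formOf (G y) b c) x a
      = ∑ i, ∑ j, ∑ m, partialDeriv i (fun y => G y j m) x * (a i * b j * c m) := by
    intro a b c
    rw [fderiv_formOf_apply hG, formOf_apply]
    simp only [Matrix.of_apply, fderiv_apply_eq_sum_partialDeriv, Finset.sum_mul]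
    rw [Finset.sum_comm_cycle]
    refine Finset.sum_congr rfl fun i _ => Finset.sum_congr rfl fun j _ =>
      Finset.sum_congr rfl fun m _ => by ring
  have hC : ∀ i j m, ∑ h, G x h m * christoffel G x h i j
      = (1 / 2) * (partialDeriv i (fun y => G y j m) x + partialDeriv j (fun y => G y i m) x
        - partialDeriv m (fun y => G y i j) x) := by
    intro i j m
    have h1 := congrFun (Matrix.mulVec_mulVec (fun l => partialDeriv i (fun y => G y j l) x
      + partialDeriv j (fun y => G y i l) x - partialDeriv l (fun y => G y i j) x)
      (G x) (G x)⁻¹) m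
    rw [Matrix.mul_nonsing_inv _ hu, Matrix.one_mulVec] at h1
    rw [← h1]
    simp only [Matrix.mulVec, dotProduct, christoffel]
    rw [Finset.mul_sum]
    refine Finset.sum_congr rfl fun h _ => ?_
    rw [hs h m]
    ring
  simp only [koszul]
  rw [hf a b l, hf b a l, hf l a b, formOf_apply]
  have e1 : ∑ i, ∑ j, ∑ m, partialDeriv i (fun y => G y j m) x * (b i * a j * l m)
      = ∑ i, ∑ j, ∑ m, partialDeriv j (fun y => G y i m) x * (a i * b j * l m) := by
    rw [Finset.sum_comm]
    exact Finset.sum_congr rfl fun i _ => Finset.sum_congr rfl fun j _ =>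
      Finset.sum_congr rfl fun m _ => by ring
  have e2 : ∑ i, ∑ j, ∑ m, partialDeriv i (fun y => G y j m) x * (l i * a j * b m)
      = ∑ i, ∑ j, ∑ m, partialDeriv m (fun y => G y i j) x * (a i * b j * l m) := by
    rw [← Finset.sum_comm_cycle]
    exact Finset.sum_congr rfl fun i _ => Finset.sum_congr rfl fun j _ =>
      Finset.sum_congr rfl fun m _ => by ring
  rw [e1, e2]
  have e3 : ∑ h, ∑ m, G x h m * (bilinOf (christoffel G x) a b h * l m)
      = ∑ i, ∑ j, ∑ m, (∑ h, G x h m * christoffel G x h i j) * (a i * b j * l m) := by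
    simp only [bilinOf_apply, Finset.sum_mul, Finset.mul_sum]
    rw [Finset.sum_comm]
    refine (Finset.sum_congr rfl fun m _ => Finset.sum_comm_cycle.symm).trans ?_
    rw [← Finset.sum_comm_cycle]
    exact Finset.sum_congr rfl fun i _ => Finset.sum_congr rfl fun j _ =>
      Finset.sum_congr rfl fun m _ => Finset.sum_congr rfl fun h _ => by ring
  rw [e3]
  simp only [hC, Finset.mul_sum, ← Finset.sum_add_distrib, ← Finset.sum_sub_distrib]
  exact Finset.sum_congr rfl fun i _ => Finset.sum_congr rfl fun j _ =>
      Finset.sum_congr rfl fun m _ => by ring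

end CoordinateTensors

/-! ### The Levi-Civita connection in coordinates and its curvature components. -/

section CoordinateConnection

open Filter Topology

variable {κ : Type*} [Fintype κ]

lemma curvatureVec_eq_sum {E : Type*} [NormedAddCommGroup E] [NormedSpace ℝ E]
    (Γ : E → E →L[ℝ] E →L[ℝ] E) (x : E) (c : κ → ℝ) (v : κ → E) (b u : E) :
    curvatureVec Γ x (∑ i, c i • v i) b u = ∑ i, c i • curvatureVec Γ x (v i) b u := by
  simp [curvatureVec, Finset.sum_add_distrib, Finset.sum_sub_distrib, smul_add, smul_sub]

lemma curvatureVec_swap {E : Type*} [NormedAddCommGroup E] [NormedSpace ℝ E]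
    (Γ : E → E →L[ℝ] E →L[ℝ] E) (x a b u : E) :
    curvatureVec Γ x a b u = -curvatureVec Γ x b a u := by
  simp only [curvatureVec]
  abel

variable [DecidableEq κ] {x : EuclideanSpace ℝ κ}

lemma partialDeriv_apply {E : Type*} [Fintype E] {F : EuclideanSpace ℝ κ → EuclideanSpace ℝ E}
    (hF : DifferentiableAt ℝ F x) (h : E) (i : κ) :
    partialDeriv i (fun y => F y h) x = fderiv ℝ F x (EuclideanSpace.single i 1) h := by
  have h1 : HasFDerivAt (fun y => F y h) ((coord h).comp (fderiv ℝ F x)) x :=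
    HasFDerivAt.comp (g := coord h) x (coord h).hasFDerivAt hF.hasFDerivAt
  rw [partialDeriv, h1.fderiv]
  rfl

lemma fderiv_apply_eq_sum {E : Type*} [Fintype E] {F : EuclideanSpace ℝ κ → EuclideanSpace ℝ E}
    (hF : DifferentiableAt ℝ F x) (h : E) (c : EuclideanSpace ℝ κ) :
    fderiv ℝ F x c h = ∑ i, c i * partialDeriv i (fun y => F y h) x := by
  simp only [partialDeriv_apply hF]
  conv_lhs => rw [eq_sum_single c]
  simp [Finset.sum_apply]

/-- The connection with the Christoffel symbols of `G` as components. -/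
def leviCivita (G : EuclideanSpace ℝ κ → Matrix κ κ ℝ) (y : EuclideanSpace ℝ κ) :
    EuclideanSpace ℝ κ →L[ℝ] EuclideanSpace ℝ κ →L[ℝ] EuclideanSpace ℝ κ :=
  bilinOf (christoffel G y)

variable {G P : EuclideanSpace ℝ κ → Matrix κ κ ℝ}

lemma leviCivita_apply (a b : EuclideanSpace ℝ κ) (h : κ) :
    leviCivita G x a b h = ∑ i, ∑ j, christoffel G x h i j * (a i * b j) :=
  bilinOf_apply _ _ _ _

lemma leviCivita_single (i : κ) (b : EuclideanSpace ℝ κ) (h : κ) :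
    leviCivita G x (EuclideanSpace.single i 1) b h = ∑ j, christoffel G x h i j * b j := by
  simp [leviCivita_apply, Finset.sum_ite_irrel]

lemma contDiffAt_leviCivita (hG : ∀ i j, ContDiffAt ℝ 2 (fun y => G y i j) x)
    (hu : IsUnit (G x).det) : ContDiffAt ℝ 1 (leviCivita G) x :=
  contDiffAt_bilinOf (contDiffAt_christoffel hG hu)

/-- The Koszul expressions for `(c, X; Y)` and `(c, Y; X)` add up to twice the derivative of `G(X,
Y)` along `c`. -/
lemma formParallelAt_leviCivita (hG : ∀ i j, ContDiffAt ℝ 2 (fun y => G y i j) x)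
    (hs : ∀ y i j, G y i j = G y j i) (hu : IsUnit (G x).det) :
    FormParallelAt (fun y => formOf (G y)) (leviCivita G) x := by
  rw [formParallelAt_iff (contDiffAt_formOf fun i j => (hG i j).of_le (by norm_num))]
  intro c X Y
  have hd : ∀ i j, DifferentiableAt ℝ (fun y => G y i j) x := fun i j =>
    (hG i j).differentiableAt (by simp)
  rw [formOf_comm (hs x) X, leviCivita, formOf_christoffel hd (hs x) hu,
    formOf_christoffel hd (hs x) hu]
  have h1 : ∀ a b, (fun y => formOf (G y) a b) = fun y => formOf (G y) b a := fun a b =>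
    funext fun y => formOf_comm (hs y) a b
  simp only [koszul]
  rw [h1 Y X, h1 c Y, h1 c X]
  ring

lemma endoParallelAt_leviCivita (hP : ∀ i j, ContDiffAt ℝ 1 (fun y => P y i j) x)
    (h : ∀ k i h, covDerivEndo G P x k i h = 0) :
    EndoParallelAt (fun y => endoOf (P y)) (leviCivita G) x := by
  have hc := contDiffAt_endoOf hP
  rw [endoParallelAt_iff hc]
  intro c X
  have hX : DifferentiableAt ℝ (fun y => endoOf (P y) X) x :=
    (hc.clm_apply contDiffAt_const).differentiableAt (by simp)
  ext a
  rw [fderiv_apply_eq_sum hX]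
  have h1 : ∀ k, partialDeriv k (fun y => endoOf (P y) X a) x
      = ∑ i, partialDeriv k (fun y => P y a i) x * X i := by
    intro k
    simp only [endoOf_apply, partialDeriv]
    rw [(HasFDerivAt.fun_sum (u := Finset.univ) fun i _ =>
      ((hP a i).differentiableAt (by simp)).hasFDerivAt.mul_const (X i)).fderiv]
    simp [mul_comm]
  have h2 : ∀ k i, partialDeriv k (fun y => P y a i) x
      = ∑ l, (christoffel G x l k i * P x a l - christoffel G x a k l * P x l i) := by
    intro k i
    have h3 := h k i a
    rw [covDerivEndo, add_eq_zero_iff_eq_neg, ← Finset.sum_neg_distrib] at h3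
    rw [h3]
    exact Finset.sum_congr rfl fun l _ => by ring
  simp only [h1, h2]
  simp only [PiLp.sub_apply, endoOf_apply, leviCivita_apply, Finset.mul_sum, Finset.sum_mul]
  have e1 : ∑ l, ∑ k, ∑ i, P x a l * (christoffel G x l k i * (c k * X i))
      = ∑ k, ∑ i, ∑ l, P x a l * (christoffel G x l k i * (c k * X i)) :=
    Finset.sum_comm_cycle.symm
  have e2 : ∑ k, ∑ l, ∑ i, christoffel G x a k l * (c k * (P x l i * X i))
      = ∑ k, ∑ i, ∑ l, christoffel G x a k l * (c k * (P x l i * X i)) :=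
    Finset.sum_congr rfl fun k _ => Finset.sum_comm
  rw [e1, e2]
  simp only [← Finset.sum_sub_distrib]
  exact Finset.sum_congr rfl fun i _ => Finset.sum_congr rfl fun j _ =>
      Finset.sum_congr rfl fun m _ => by ring

lemma curvatureVec_apply (hG : ∀ i j, ContDiffAt ℝ 2 (fun y => G y i j) x)
    (hu : IsUnit (G x).det) (i j : κ) (u : EuclideanSpace ℝ κ) (h : κ) :
    curvatureVec (leviCivita G) x (EuclideanSpace.single i 1) (EuclideanSpace.single j 1) u h
      = ∑ k, curvature G x i j k h * u k := by
  have hc := contDiffAt_leviCivita hG hu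
  have hd : ∀ a, DifferentiableAt ℝ (fun y => leviCivita G y a u) x := fun a =>
    ((hc.clm_apply contDiffAt_const).clm_apply contDiffAt_const).differentiableAt (by simp)
  have h1 : ∀ i j, fderiv ℝ (fun y => leviCivita G y (EuclideanSpace.single j 1) u) x
      (EuclideanSpace.single i 1) h
      = ∑ k, partialDeriv i (fun y => christoffel G y h j k) x * u k := by
    intro i j
    rw [← partialDeriv_apply (hd _)]
    simp only [leviCivita_single, partialDeriv]
    rw [(HasFDerivAt.fun_sum (u := Finset.univ) fun k _ =>
      ((contDiffAt_christoffel hG hu h j k).differentiableAt (by simp)).hasFDerivAt.mul_const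
        (u k)).fderiv]
    simp [mul_comm]
  have h2 : ∀ i j, ∑ l, christoffel G x h i l * ∑ k, christoffel G x l j k * u k
      = ∑ k, ∑ l, christoffel G x h i l * christoffel G x l j k * u k := by
    intro i j
    simp only [Finset.mul_sum]
    rw [Finset.sum_comm]
    exact Finset.sum_congr rfl fun k _ => Finset.sum_congr rfl fun l _ => by ring
  rw [curvatureVec_eq hc]
  simp only [PiLp.sub_apply, PiLp.add_apply, h1, leviCivita_single, h2, curvature]
  simp only [← Finset.sum_sub_distrib, ← Finset.sum_add_distrib, add_mul, sub_mul, Finset.sum_mul]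
  refine Finset.sum_congr rfl fun k _ => ?_
  rw [Finset.sum_sub_distrib]
  ring

/-- The vector with components `R^h_{.ilm} v^l u^m` represents `X ↦ G(v, R(∂_i, X)u)`. -/
lemma formOf_curvatureUp (hG : ∀ i j, ContDiffAt ℝ 2 (fun y => G y i j) x)
    (hs : ∀ y i j, G y i j = G y j i) (hu : ∀ᶠ y in 𝓝 x, IsUnit (G y).det) (i : κ)
    (v u X : EuclideanSpace ℝ κ) :
    formOf (G x) (WithLp.toLp 2 fun h => ∑ l, ∑ m, v l * curvatureUp G x h i l m * u m) X
      = formOf (G x) v (curvatureVec (leviCivita G) x (EuclideanSpace.single i 1) X u) := by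
  have hu0 := hu.self_of_nhds
  have hp : ∀ᶠ y in 𝓝 x, FormParallelAt (fun y => formOf (G y)) (leviCivita G) y := by
    have h1 : ∀ᶠ y in 𝓝 x, ∀ i j, ContDiffAt ℝ 2 (fun y => G y i j) y :=
      eventually_all.2 fun i => eventually_all.2 fun j => (hG i j).eventually (by simp)
    filter_upwards [hu, h1] with y hy hy1 using formParallelAt_leviCivita hy1 hs hy
  -- Two sign changes turn `G(v, R(∂_i, X)u)` into `G(R(X, ∂_i)v, u)`, the contraction from which
  -- `curvatureUp` is built. Skewness suffices; the pair symmetry of the curvature tensor is not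
  -- needed.
  rw [curvatureVec_swap, map_neg]
  rw [← curvatureVec_skew (contDiffAt_formOf hG)
    ((contDiffAt_leviCivita hG hu0).differentiableAt (by simp)) hp]
  conv_rhs => rw [eq_sum_single X, curvatureVec_eq_sum]
  simp only [map_sum, map_smul, sum_apply, smul_apply, smul_eq_mul]
  rw [formOf_apply, Finset.sum_comm]
  refine Finset.sum_congr rfl fun k _ => ?_
  rw [formOf_apply]
  simp only [curvatureVec_apply hG hu0]
  have h1 : ∀ l m, ∑ h, G x h k * curvatureUp G x h i l m = ∑ s, curvature G x k i l s * G x s m := by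
    intro l m
    have h2 : (G x)⁻¹ * G x = 1 := Matrix.nonsing_inv_mul _ hu0
    simp only [curvatureUp, Finset.mul_sum]
    rw [← Finset.sum_comm_cycle]
    rw [Finset.sum_comm]
    refine Finset.sum_congr rfl fun s _ => ?_
    have h3 : ∀ a, ∑ h, G x h k * (curvature G x a i l s * (G x)⁻¹ a h * G x s m)
        = curvature G x a i l s * G x s m * (1 : Matrix κ κ ℝ) a k := by
      intro a
      rw [← h2, Matrix.mul_apply, Finset.mul_sum]
      exact Finset.sum_congr rfl fun h _ => by ring
    simp only [h3, Matrix.one_apply]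
    simp
  have e1 : ∑ h, G x h k * ((∑ l, ∑ m, v l * curvatureUp G x h i l m * u m) * X k)
      = X k * ∑ l, ∑ m, v l * u m * ∑ h, G x h k * curvatureUp G x h i l m := by
    simp only [Finset.sum_mul, Finset.mul_sum]
    rw [← Finset.sum_comm_cycle]
    exact Finset.sum_congr rfl fun k _ => Finset.sum_congr rfl fun l _ =>
      Finset.sum_congr rfl fun l _ => by ring
  refine e1.trans ?_
  simp only [h1]
  congr 1
  simp only [Finset.sum_mul, Finset.mul_sum]
  rw [Finset.sum_comm_cycle]
  refine Finset.sum_congr rfl fun s _ => ?_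
  rw [Finset.sum_comm]
  exact Finset.sum_congr rfl fun k _ => Finset.sum_congr rfl fun l _ => by ring

end CoordinateConnection

/-! ### The adapted frame on the tangent bundle. -/

section TangentSpaceCoordinates

open Filter Topology

variable {n : ℕ}

/-- The base coordinates as a continuous linear map. -/
def baseL : EuclideanSpace ℝ (Fin n ⊕ Fin n) →L[ℝ] EuclideanSpace ℝ (Fin n) :=
  LinearMap.toContinuousLinearMap
    { toFun := base, map_add' := fun _ _ => rfl, map_smul' := fun _ _ => rfl }

/-- The fibre coordinates as a continuous linear map. -/
def fibreL : EuclideanSpace ℝ (Fin n ⊕ Fin n) →L[ℝ] EuclideanSpace ℝ (Fin n) :=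
  LinearMap.toContinuousLinearMap
    { toFun := fibre, map_add' := fun _ _ => rfl, map_smul' := fun _ _ => rfl }

@[simp] lemma baseL_pair (a b : EuclideanSpace ℝ (Fin n)) : baseL (pair a b) = a := rfl

@[simp] lemma fibreL_pair (a b : EuclideanSpace ℝ (Fin n)) : fibreL (pair a b) = b := rfl

lemma pair_baseL_fibreL (z : EuclideanSpace ℝ (Fin n ⊕ Fin n)) :
    pair (baseL z) (fibreL z) = z := by
  ext i
  cases i <;> rfl

variable {G P : EuclideanSpace ℝ (Fin n) → Matrix (Fin n) (Fin n) ℝ}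

lemma christoffelVec_eq (x a u : EuclideanSpace ℝ (Fin n)) :
    christoffelVec G x a u = leviCivita G x a u := by
  ext h
  simp only [christoffelVec, leviCivita_apply, mul_assoc]

lemma connector_eq (z a : EuclideanSpace ℝ (Fin n ⊕ Fin n)) :
    connector G z a = verticalPart baseL fibreL (leviCivita G) z a := by
  rw [connector, christoffelVec_eq]
  rfl

section VerticalPart

variable {E Z : Type*} [NormedAddCommGroup E] [NormedSpace ℝ E] [NormedAddCommGroup Z]
  [NormedSpace ℝ Z] (π ρ : Z →L[ℝ] E) (Γ : E → E →L[ℝ] E →L[ℝ] E) (z : Z)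

/-- `verticalPart` as a linear map in the tangent vector. -/
def verticalPartL : Z →ₗ[ℝ] E :=
  (ρ + ((Γ (π z)).flip (ρ z)).comp π : Z →L[ℝ] E)

lemma verticalPartL_apply (a : Z) : verticalPartL π ρ Γ z a = verticalPart π ρ Γ z a := rfl

end VerticalPart

/-- A vector is determined by its components in the adapted frame. -/
lemma eq_sum_frame_iff (z w : EuclideanSpace ℝ (Fin n ⊕ Fin n)) (α β : Fin n → ℝ) :
    w = ∑ h, α h • frameH G z h + ∑ h, β h • frameV h
      ↔ baseL w = WithLp.toLp 2 α
        ∧ verticalPart baseL fibreL (leviCivita G) z w = WithLp.toLp 2 β := by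
  have hα : WithLp.toLp 2 α = ∑ h, α h • EuclideanSpace.single h (1 : ℝ) := eq_sum_single _
  have hβ : WithLp.toLp 2 β = ∑ h, β h • EuclideanSpace.single h (1 : ℝ) := eq_sum_single _
  have bH : ∀ h, baseL (frameH G z h) = EuclideanSpace.single h 1 := fun h => rfl
  have bV : ∀ h : Fin n, baseL (frameV h) = 0 := fun h => rfl
  have vH : ∀ h, verticalPart baseL fibreL (leviCivita G) z (frameH G z h) = 0 := fun h => by
    rw [← connector_eq, frameH, connector_horizontalLift]
  have vV : ∀ h, verticalPart baseL fibreL (leviCivita G) z (frameV h)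
      = EuclideanSpace.single h 1 := fun h => by
    rw [← connector_eq, frameV, connector_verticalLift]
  have h1 : baseL (∑ h, α h • frameH G z h + ∑ h, β h • frameV h) = WithLp.toLp 2 α := by
    simp only [map_add, map_sum, map_smul, bH, bV, smul_zero, Finset.sum_const_zero, add_zero, hα]
  have h2 : verticalPart baseL fibreL (leviCivita G) z
      (∑ h, α h • frameH G z h + ∑ h, β h • frameV h) = WithLp.toLp 2 β := by
    rw [← verticalPartL_apply]
    simp only [map_add, map_sum, map_smul, verticalPartL_apply, vH, vV, smul_zero,
      Finset.sum_const_zero, zero_add, hβ]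
  refine ⟨fun h => h ▸ ⟨h1, h2⟩, fun ⟨h3, h4⟩ => ?_⟩
  rw [← h1] at h3
  -- Once the bases agree, the connection terms agree, so equal vertical parts force equal fibre
  -- coordinates.
  rw [← h2, verticalPart, verticalPart, h3, add_left_inj] at h4
  rw [← pair_baseL_fibreL w, h3, h4, pair_baseL_fibreL]

end TangentSpaceCoordinates

/-! ### Covariant derivatives of a vector field read off from its section. -/

section SecondFundamentalForm

open Filter Topology

variable {n : ℕ} {G P : EuclideanSpace ℝ (Fin n) → Matrix (Fin n) (Fin n) ℝ}
  {V : EuclideanSpace ℝ (Fin n) → EuclideanSpace ℝ (Fin n)} {x : EuclideanSpace ℝ (Fin n)}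

/-- The derivative in the direction `∂_i` of the section `x ↦ (x, V x)`. -/
def sectionDeriv (V : EuclideanSpace ℝ (Fin n) → EuclideanSpace ℝ (Fin n))
    (x : EuclideanSpace ℝ (Fin n)) (i : Fin n) : EuclideanSpace ℝ (Fin n ⊕ Fin n) :=
  pair (EuclideanSpace.single i 1) (fderiv ℝ V x (EuclideanSpace.single i 1))

lemma covDeriv_eq (hV : DifferentiableAt ℝ V x) (i h : Fin n) :
    covDeriv G V x i h
      = verticalPart baseL fibreL (leviCivita G) (pair x (V x)) (sectionDeriv V x i) h := by
  simp [covDeriv, verticalPart, sectionDeriv, partialDeriv_apply hV, leviCivita_single]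

/-- Differentiating `∂_j V + Γ(∂_j, V)` along `∂_i` and adding `Γ(∂_i, ∇_j V)` gives the second
partial derivative plus exactly the three terms of `verticalPartDeriv`. -/
lemma covDeriv₂_eq (hG : ∀ i j, ContDiffAt ℝ 2 (fun y => G y i j) x)
    (hu : IsUnit (G x).det) (hV : ContDiffAt ℝ 2 V x) (i j h : Fin n) :
    covDeriv₂ G V x i j h
      = (fderiv ℝ (fun y => fderiv ℝ V y (EuclideanSpace.single j 1)) x (EuclideanSpace.single i 1)
        + verticalPartDeriv baseL fibreL (leviCivita G) (pair x (V x)) (sectionDeriv V x i)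
          (sectionDeriv V x j)) h
        - ∑ k, christoffel G x k i j * covDeriv G V x k h := by
  have hV1 : DifferentiableAt ℝ V x := hV.differentiableAt (by simp)
  have hΓ := contDiffAt_leviCivita hG hu
  have hΓj : ContDiffAt ℝ 1 (fun y => leviCivita G y (EuclideanSpace.single j 1)) x :=
    hΓ.clm_apply contDiffAt_const
  have hVj : ContDiffAt ℝ 1 (fun y => fderiv ℝ V y (EuclideanSpace.single j 1)) x :=
    (hV.fderiv_right (m := 1) (by norm_num)).clm_apply contDiffAt_const
  have hd : ∀ᶠ y in 𝓝 x, DifferentiableAt ℝ V y :=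
    (hV.eventually (by simp)).mono fun y hy => hy.differentiableAt (by simp)
  have h1 : (fun y => covDeriv G V y j h) =ᶠ[𝓝 x] fun y =>
      (fderiv ℝ V y (EuclideanSpace.single j 1)
        + leviCivita G y (EuclideanSpace.single j 1) (V y)) h := by
    filter_upwards [hd] with y hy
    rw [covDeriv_eq hy]
    rfl
  have hs : ContDiffAt ℝ 1 (fun y => fderiv ℝ V y (EuclideanSpace.single j 1)
        + leviCivita G y (EuclideanSpace.single j 1) (V y)) x :=
    hVj.add (hΓj.clm_apply (hV.of_le (by norm_num)))
  have h2 : fderiv ℝ (fun y => fderiv ℝ V y (EuclideanSpace.single j 1)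
        + leviCivita G y (EuclideanSpace.single j 1) (V y)) x (EuclideanSpace.single i 1)
      = fderiv ℝ (fun y => fderiv ℝ V y (EuclideanSpace.single j 1)) x
          (EuclideanSpace.single i 1)
        + (leviCivita G x (EuclideanSpace.single j 1)
            (fderiv ℝ V x (EuclideanSpace.single i 1))
          + fderiv ℝ (leviCivita G) x (EuclideanSpace.single i 1) (EuclideanSpace.single j 1)
            (V x)) := by
    rw [((hVj.differentiableAt (by simp)).hasFDerivAt.fun_add
      ((hΓj.differentiableAt (by simp)).hasFDerivAt.clm_apply hV1.hasFDerivAt)).fderiv,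
      ← fderiv_clm_apply_const hΓ]
    rfl
  rw [covDeriv₂, partialDeriv, h1.fderiv_eq, ← partialDeriv,
    partialDeriv_apply (hs.differentiableAt (by simp)), h2]
  simp only [covDeriv_eq hV1, ← leviCivita_single]
  simp only [verticalPartDeriv, baseL_pair, fibreL_pair, sectionDeriv, PiLp.add_apply]
  ring

end SecondFundamentalForm

/-! ### The second fundamental form of a section in coordinates. -/

section CoordinateTheorem

open Filter Topology

variable {n : ℕ} {G P : EuclideanSpace ℝ (Fin n) → Matrix (Fin n) (Fin n) ℝ}
  {V : EuclideanSpace ℝ (Fin n) → EuclideanSpace ℝ (Fin n)} {x : EuclideanSpace ℝ (Fin n)}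
  {δ : ℝ} {S : EuclideanSpace ℝ (Fin n ⊕ Fin n) → Matrix (Fin n ⊕ Fin n) (Fin n ⊕ Fin n) ℝ}
  {F : EuclideanSpace ℝ (Fin n) → EuclideanSpace ℝ (Fin n ⊕ Fin n)}

/-- The Berger type deformed Sasaki metric of component matrices `G`, `P`. -/
def coordSasaki (G P : EuclideanSpace ℝ (Fin n) → Matrix (Fin n) (Fin n) ℝ) (δ : ℝ)
    (z a b : EuclideanSpace ℝ (Fin n ⊕ Fin n)) : ℝ :=
  deformedSasaki baseL fibreL (fun y => formOf (G y)) (leviCivita G) (fun y => endoOf (P y)) δ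
    z a b

/-- The deformation adds a square. If the base component vanishes, the vertical part is the fibre
component itself, which is then nonzero. -/
lemma coordSasaki_self_pos {z a : EuclideanSpace ℝ (Fin n ⊕ Fin n)}
    (hpos : ∀ v, v ≠ 0 → 0 < formOf (G (baseL z)) v v) (ha : a ≠ 0) :
    0 < coordSasaki G P δ z a a := by
  have h0 : ∀ v, 0 ≤ formOf (G (baseL z)) v v := fun v => by
    by_cases hv : v = 0
    · simp [hv]
    · exact (hpos v hv).le
  simp only [coordSasaki, deformedSasaki, deformedForm]
  have h1 : ∀ t : ℝ, 0 ≤ δ ^ 2 * t * t := fun t => by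
    rw [mul_assoc]; exact mul_nonneg (sq_nonneg δ) (mul_self_nonneg t)
  by_cases hb : baseL a = 0
  · have hf : fibreL a ≠ 0 := fun hf => ha (by
      rw [← pair_baseL_fibreL a, hb, hf]
      ext i
      cases i <;> rfl)
    have h2 : verticalPart baseL fibreL (leviCivita G) z a = fibreL a := by
      simp [verticalPart, hb]
    rw [h2]
    linarith [h0 (baseL a), hpos _ hf, h1 (formOf (G (baseL z)) (fibreL a)
      (endoOf (P (baseL z)) (fibreL z)))]
  · linarith [hpos _ hb, h0 (verticalPart baseL fibreL (leviCivita G) z a),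
      h1 (formOf (G (baseL z)) (verticalPart baseL fibreL (leviCivita G) z a)
      (endoOf (P (baseL z)) (fibreL z)))]

/-- Component matrices near `x` of an anti-paraKähler structure. -/
structure IsAntiParaKahlerCoord (G P : EuclideanSpace ℝ (Fin n) → Matrix (Fin n) (Fin n) ℝ)
    (x : EuclideanSpace ℝ (Fin n)) : Prop where
  contDiff_metric : ∀ i j, ContDiffAt ℝ 2 (fun y => G y i j) x
  contDiff_endo : ∀ i j, ContDiffAt ℝ 2 (fun y => P y i j) x
  metric_symm : ∀ y i j, G y i j = G y j i
  metric_pos : ∀ᶠ y in 𝓝 x, ∀ v, v ≠ 0 → 0 < formOf (G y) v v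
  involutive : ∀ v, endoOf (P x) (endoOf (P x) v) = v
  isometry : ∀ v w, formOf (G x) (endoOf (P x) v) (endoOf (P x) w) = formOf (G x) v w
  parallel : ∀ᶠ y in 𝓝 x, ∀ k i h, covDerivEndo G P y k i h = 0

namespace IsAntiParaKahlerCoord

variable (h : IsAntiParaKahlerCoord G P x)
include h

lemma isUnit_det : ∀ᶠ y in 𝓝 x, IsUnit (G y).det :=
  h.metric_pos.mono fun _ hy => isUnit_det_of_formOf_pos hy

lemma formParallel : ∀ᶠ y in 𝓝 x, FormParallelAt (fun y => formOf (G y)) (leviCivita G) y := by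
  have h1 : ∀ᶠ y in 𝓝 x, ∀ i j, ContDiffAt ℝ 2 (fun y => G y i j) y :=
    eventually_all.2 fun i => eventually_all.2 fun j =>
      (h.contDiff_metric i j).eventually (by simp)
  filter_upwards [h.isUnit_det, h1] with y hy hy1 using
    formParallelAt_leviCivita hy1 h.metric_symm hy

lemma endoParallel : ∀ᶠ y in 𝓝 x, EndoParallelAt (fun y => endoOf (P y)) (leviCivita G) y := by
  have h1 : ∀ᶠ y in 𝓝 x, ∀ i j, ContDiffAt ℝ 2 (fun y => P y i j) y :=
    eventually_all.2 fun i => eventually_all.2 fun j =>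
      (h.contDiff_endo i j).eventually (by simp)
  filter_upwards [h.parallel, h1] with y hy hy1 using
    endoParallelAt_leviCivita (fun i j => (hy1 i j).of_le (by norm_num)) hy

/-- The Levi-Civita connection of a metric `S` that agrees with the deformed Sasaki metric. -/
lemma bilinOf_christoffel_eq {z : EuclideanSpace ℝ (Fin n ⊕ Fin n)} (hz : baseL z = x)
    (hS : ∀ᶠ w in 𝓝 z, ∀ a b, formOf (S w) a b = coordSasaki G P δ w a b)
    (hSs : ∀ α β, S z α β = S z β α) {a b Y : EuclideanSpace ℝ (Fin n ⊕ Fin n)}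
    {W : EuclideanSpace ℝ (Fin n)}
    (hW : ∀ X, formOf (G x) W X
      = formOf (G x) (verticalPart baseL fibreL (leviCivita G) z b)
          (curvatureVec (leviCivita G) x (baseL a) X (fibreL z))
        + formOf (G x) (verticalPart baseL fibreL (leviCivita G) z a)
          (curvatureVec (leviCivita G) x (baseL b) X (fibreL z)))
    (hπ : baseL Y = leviCivita G x (baseL a) (baseL b) + (1 / 2 : ℝ) • W)
    (hK : verticalPart baseL fibreL (leviCivita G) z Y
      = (1 / 2 : ℝ) • (verticalPartDeriv baseL fibreL (leviCivita G) z a b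
          + verticalPartDeriv baseL fibreL (leviCivita G) z b a)
        + (δ ^ 2 / (1 + δ ^ 2 * formOf (G x) (fibreL z) (fibreL z))
          * formOf (G x) (verticalPart baseL fibreL (leviCivita G) z a)
            (endoOf (P x) (verticalPart baseL fibreL (leviCivita G) z b)))
          • endoOf (P x) (fibreL z)) :
    bilinOf (christoffel S z) a b = Y := by
  subst hz
  have hu := h.isUnit_det.self_of_nhds
  have hpos := h.metric_pos.self_of_nhds
  have hG := contDiffAt_formOf h.contDiff_metric
  have hP := contDiffAt_endoOf h.contDiff_endo
  have hΓ := contDiffAt_leviCivita h.contDiff_metric hu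
  have hSz := hS.self_of_nhds
  have hSe : ∀ a b, (fun w => formOf (S w) a b) =ᶠ[𝓝 z] fun w => coordSasaki G P δ w a b :=
    fun a b => hS.mono fun w hw => hw a b
  have hSp : ∀ a, a ≠ 0 → 0 < formOf (S z) a a := fun a ha => by
    rw [hSz]
    exact coordSasaki_self_pos hpos ha
  -- The entries of `S` are its values on basis vectors, hence inherit differentiability from the
  -- deformed metric.
  have hSd : ∀ α β, DifferentiableAt ℝ (fun w => S w α β) z := by
    intro α β
    have h1 := (differentiableAt_deformedSasaki (δ := δ) (hG.of_le (by norm_num)) hΓ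
      (hP.of_le (by norm_num)) (EuclideanSpace.single α 1) (EuclideanSpace.single β 1) :
        DifferentiableAt ℝ (fun w => coordSasaki G P δ w _ _) z)
    refine h1.congr_of_eventuallyEq (EventuallyEq.trans (Eventually.of_forall fun w => ?_) (hSe _ _))
    simp [formOf_apply]
  have hk : ∀ l, formOf (S z) (bilinOf (christoffel S z) a b) l = formOf (S z) Y l := by
    intro l
    have h2 := deformedSasaki_eq_half_koszul (δ := δ) (z := z) hG hΓ hP h.formParallel
      h.endoParallel
      (formOf_comm (h.metric_symm _)) (bilinOf_comm (christoffel_comm h.metric_symm))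
      h.involutive h.isometry (by
        by_cases hv : fibreL z = 0
        · simp [hv]
        · exact (hpos _ hv).le) hW hπ hK l
    rw [formOf_christoffel hSd hSs (isUnit_det_of_formOf_pos hSp), hSz]
    refine Eq.trans ?_ h2.symm
    simp only [koszul]
    rw [(hSe b l).fderiv_eq, (hSe a l).fderiv_eq, (hSe a b).fderiv_eq]
    rfl
  -- Both vectors pair equally with every `l`, so their difference would be a nonzero null vector of
  -- a positive form.
  by_contra hne
  have h3 := hSp _ (sub_ne_zero.2 hne)
  have h4 : formOf (S z) (bilinOf (christoffel S z) a b - Y) = 0 := by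
    rw [map_sub, sub_eq_zero]
    exact ContinuousLinearMap.ext hk
  simp [h4] at h3

end IsAntiParaKahlerCoord

/-- The base coordinates of a section are the identity, so their second derivatives vanish and only
`V` contributes. The shape of `F` is required near `x` because two derivatives are taken. -/
lemma secondFundamentalForm_section (hV : ContDiffAt ℝ 2 V x)
    (hF : ∀ᶠ y in 𝓝 x, F y = pair y (V y)) (i j : Fin n) :
    WithLp.toLp 2 (secondFundamentalForm G S F x i j)
      = pair 0 (fderiv ℝ (fun y => fderiv ℝ V y (EuclideanSpace.single j 1)) x
          (EuclideanSpace.single i 1))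
        - ∑ k, christoffel G x k i j • sectionDeriv V x k
        + bilinOf (christoffel S (pair x (V x))) (sectionDeriv V x i) (sectionDeriv V x j) := by
  have hd : ∀ᶠ y in 𝓝 x, DifferentiableAt ℝ V y :=
    (hV.eventually (by simp)).mono fun y hy => hy.differentiableAt (by simp)
  have hl : ∀ (k a : Fin n) (y : EuclideanSpace ℝ (Fin n)), partialDeriv k (fun w => w a) y
      = EuclideanSpace.single k (1 : ℝ) a := fun k a y => by
    rw [partialDeriv]
    exact congrArg (fun L => L (EuclideanSpace.single k 1)) (coord a).hasFDerivAt.fderiv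
  have h1 : ∀ᶠ y in 𝓝 x, ∀ k γ, partialDeriv k (fun w => F w γ) y = sectionDeriv V y k γ := by
    filter_upwards [hF.eventually_nhds, hd] with y hy hdy k γ
    rw [partialDeriv, (show (fun w => F w γ) =ᶠ[𝓝 y] fun w => pair w (V w) γ from
      hy.mono fun w hw => by simp only [hw]).fderiv_eq, ← partialDeriv]
    cases γ with
    | inl a => exact hl k a y
    | inr a => exact partialDeriv_apply hdy a k
  have h2 : ∀ γ, partialDeriv i (fun y => partialDeriv j (fun w => F w γ) y) x
      = pair 0 (fderiv ℝ (fun y => fderiv ℝ V y (EuclideanSpace.single j 1)) x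
          (EuclideanSpace.single i 1)) γ := by
    intro γ
    rw [partialDeriv, (show (fun y => partialDeriv j (fun w => F w γ) y) =ᶠ[𝓝 x]
      fun y => sectionDeriv V y j γ from h1.mono fun y hy => hy j γ).fderiv_eq]
    cases γ with
    | inl a =>
      change fderiv ℝ (fun _ => EuclideanSpace.single j (1 : ℝ) a) x _ = 0
      simp
    | inr a =>
      rw [← partialDeriv]
      exact partialDeriv_apply (((hV.fderiv_right (m := 1) (by norm_num)).clm_apply
        contDiffAt_const).differentiableAt (by simp)) a i
  have h3 := h1.self_of_nhds
  ext γ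
  simp only [secondFundamentalForm, h2, h3, hF.self_of_nhds, PiLp.add_apply, PiLp.sub_apply,
    bilinOf_apply, mul_assoc, WithLp.ofLp_sum, Finset.sum_apply, PiLp.smul_apply, smul_eq_mul]

/-- Translates the index contraction with `tensorA` into the invariant deformation term of the
connection. -/
lemma sum_mul_formOf_endoOf (A Q : Matrix (Fin n) (Fin n) ℝ) (c : ℝ)
    (v w u : EuclideanSpace ℝ (Fin n)) (h : Fin n) :
    ∑ m, ∑ s, v m * w s * (c * ∑ k, Q k s * (∑ l, Q h l * u l) * A m k)
      = c * formOf A v (endoOf Q w) * endoOf Q u h := by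
  rw [endoOf_apply Q u h]
  generalize ∑ l, Q h l * u l = p
  simp only [formOf_apply, endoOf_apply, Finset.mul_sum, Finset.sum_mul]
  refine Finset.sum_congr rfl fun m _ => ?_
  rw [Finset.sum_comm]
  exact Finset.sum_congr rfl fun k _ => Finset.sum_congr rfl fun s _ => by ring

/-- The components of the second fundamental form of a section in the adapted frame. -/
lemma secondFundamentalForm_section_eq (h : IsAntiParaKahlerCoord G P x) (hV : ContDiffAt ℝ 2 V x)
    (hF : ∀ᶠ y in 𝓝 x, F y = pair y (V y))
    (hS : ∀ᶠ w in 𝓝 (pair x (V x)), ∀ a b, formOf (S w) a b = coordSasaki G P δ w a b)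
    (hSs : ∀ α β, S (pair x (V x)) α β = S (pair x (V x)) β α) (i j : Fin n) :
    WithLp.toLp 2 (secondFundamentalForm G S F x i j)
      = ∑ h, ((1 / 2 : ℝ) * (∑ l, ∑ m, covDeriv G V x j l * curvatureUp G x h i l m * V x m
          + ∑ l, ∑ m, covDeriv G V x i l * curvatureUp G x h j l m * V x m))
            • frameH G (pair x (V x)) h
        + ∑ h, (-(1 / 2 : ℝ) * ∑ m, curvature G x i j m h * V x m + covDeriv₂ G V x i j h
          + ∑ m, ∑ s, covDeriv G V x i m * covDeriv G V x j s
            * (δ ^ 2 / (1 + δ ^ 2 * ∑ k, ∑ l, G x k l * V x k * V x l)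
              * ∑ k, P x k s * (∑ l, P x h l * V x l) * G x m k)) • frameV h := by
  have hu := h.isUnit_det.self_of_nhds
  have hV1 : DifferentiableAt ℝ V x := hV.differentiableAt (by simp)
  set z := pair x (V x) with hz
  set K := verticalPart baseL fibreL (leviCivita G) z with hKdef
  set N := verticalPartDeriv baseL fibreL (leviCivita G) z with hNdef
  set f := sectionDeriv V x with hf
  have hD : ∀ i l, covDeriv G V x i l = K (f i) l := fun i l => covDeriv_eq hV1 i l
  set W : EuclideanSpace ℝ (Fin n) :=
    WithLp.toLp 2 (fun h => ∑ l, ∑ m, K (f j) l * curvatureUp G x h i l m * V x m)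
      + WithLp.toLp 2 (fun h => ∑ l, ∑ m, K (f i) l * curvatureUp G x h j l m * V x m) with hWdef
  set Q : EuclideanSpace ℝ (Fin n) := (1 / 2 : ℝ) • (N (f i) (f j) + N (f j) (f i))
        + (δ ^ 2 / (1 + δ ^ 2 * formOf (G x) (V x) (V x))
          * formOf (G x) (K (f i)) (endoOf (P x) (K (f j)))) • endoOf (P x) (V x) with hQ
  set B : EuclideanSpace ℝ (Fin n) := leviCivita G x (EuclideanSpace.single i 1)
    (EuclideanSpace.single j 1) + (1 / 2 : ℝ) • W with hB
  -- Subtracting the connection term from the fibre component makes `Q` the vertical part of `Y`.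
  set Y : EuclideanSpace ℝ (Fin n ⊕ Fin n) := pair B (Q - leviCivita G x B (V x)) with hY
  have hKY : K Y = Q := by
    change (Q - leviCivita G x B (V x)) + leviCivita G x B (V x) = Q
    abel
  have hT : bilinOf (christoffel S z) (f i) (f j) = Y := by
    refine h.bilinOf_christoffel_eq (W := W) rfl hS hSs ?_ rfl hKY
    intro X
    rw [hWdef, map_add, add_apply,
      formOf_curvatureUp h.contDiff_metric h.metric_symm h.isUnit_det,
      formOf_curvatureUp h.contDiff_metric h.metric_symm h.isUnit_det]
    rfl
  have hR : N (f i) (f j) - N (f j) (f i) = curvatureVec (leviCivita G) x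
      (EuclideanSpace.single i 1) (EuclideanSpace.single j 1) (V x) :=
    verticalPartDeriv_sub_comm (f i) (f j)
  have hKL : ∀ a, K a = verticalPartL baseL fibreL (leviCivita G) z a := fun a => rfl
  rw [secondFundamentalForm_section hV hF, hT, eq_sum_frame_iff]
  constructor
  · ext a
    simp only [map_add, map_sub, map_sum, map_smul, hY, baseL_pair, hB, hf, sectionDeriv, hWdef,
      hD]
    simp [leviCivita_single, Finset.sum_apply, Pi.single_apply]
    ring
  · change K _ = _
    have hK0 : ∀ v, K (pair 0 v) = v := fun v => by
      simp [hKdef, verticalPart]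
    rw [hKL]
    simp only [map_add, map_sub, map_sum, map_smul]
    simp only [← hKL, hKY, hK0]
    ext a
    have hRa := congrArg (fun v => v a) hR
    simp only [PiLp.sub_apply] at hRa
    rw [curvatureVec_apply h.contDiff_metric hu] at hRa
    change _ = -(1 / 2 : ℝ) * ∑ m, curvature G x i j m a * V x m + covDeriv₂ G V x i j a
      + ∑ m, ∑ s, covDeriv G V x i m * covDeriv G V x j s
        * (δ ^ 2 / (1 + δ ^ 2 * ∑ k, ∑ l, G x k l * V x k * V x l)
          * ∑ k, P x k s * (∑ l, P x a l * V x l) * G x m k)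
    -- With `R = N(f i, f j) - N(f j, f i)`, the sum `-½R + N(f i, f j)` is the symmetric average
    -- that occurs in `Q`.
    rw [← hRa, covDeriv₂_eq h.contDiff_metric hu hV]
    have hA : ∑ m, ∑ s, K (f i) m * K (f j) s
            * (δ ^ 2 / (1 + δ ^ 2 * ∑ k, ∑ l, G x k l * V x k * V x l)
              * ∑ k, P x k s * (∑ l, P x a l * V x l) * G x m k)
        = δ ^ 2 / (1 + δ ^ 2 * formOf (G x) (V x) (V x))
          * formOf (G x) (K (f i)) (endoOf (P x) (K (f j))) * endoOf (P x) (V x) a := by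
      rw [← show ∑ k, ∑ l, G x k l * V x k * V x l = formOf (G x) (V x) (V x) by
        simp only [formOf_apply, mul_assoc]]
      exact sum_mul_formOf_endoOf _ _ _ _ _ _ _
    simp only [hD, hA, hQ, PiLp.add_apply, PiLp.sub_apply, PiLp.smul_apply, smul_eq_mul,
      WithLp.ofLp_sum, Finset.sum_apply]
    rw [← hNdef]
    ring

end CoordinateTheorem

/-! ### Traces against a symmetric matrix. -/

section TensionAlgebra

variable {ι : Type*} [Fintype ι]

lemma sum_mul_eq_of_swap {g : ι → ι → ℝ} (hg : ∀ i j, g i j = g j i) (a : ι → ι → ℝ) :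
    ∑ i, ∑ j, g i j * a j i = ∑ i, ∑ j, g i j * a i j := by
  rw [Finset.sum_comm]
  exact Finset.sum_congr rfl fun i _ => Finset.sum_congr rfl fun j _ => by rw [hg]

lemma sum_mul_half_add_swap {g : ι → ι → ℝ} (hg : ∀ i j, g i j = g j i) (a : ι → ι → ℝ) :
    ∑ i, ∑ j, g i j * ((1 / 2 : ℝ) * (a i j + a j i)) = ∑ i, ∑ j, g i j * a i j := by
  have h : ∑ i, ∑ j, g i j * ((1 / 2 : ℝ) * (a i j + a j i))
      = (1 / 2 : ℝ) * (∑ i, ∑ j, g i j * a i j + ∑ i, ∑ j, g i j * a j i) := by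
    simp only [← Finset.sum_add_distrib, Finset.mul_sum]
    exact Finset.sum_congr rfl fun i _ => Finset.sum_congr rfl fun j _ => by ring
  rw [h, sum_mul_eq_of_swap hg]
  ring

lemma sum_mul_eq_zero_of_antisymm {g r : ι → ι → ℝ} (hg : ∀ i j, g i j = g j i)
    (hr : ∀ i j, r i j = -r j i) : ∑ i, ∑ j, g i j * r i j = 0 := by
  have h := sum_mul_eq_of_swap hg r
  have h2 : ∑ i, ∑ j, g i j * r j i = -∑ i, ∑ j, g i j * r i j := by
    simp only [← Finset.sum_neg_distrib]
    exact Finset.sum_congr rfl fun i _ => Finset.sum_congr rfl fun j _ => by rw [hr j i]; ring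
  linarith

lemma sum_smul_frame {E : Type*} [AddCommGroup E] [Module ℝ E] (g : ι → ι → ℝ)
    (α β : ι → ι → ι → ℝ) (A B : ι → E) :
    ∑ i, ∑ j, g i j • (∑ h, α i j h • A h + ∑ h, β i j h • B h)
      = ∑ h, (∑ i, ∑ j, g i j * α i j h) • A h + ∑ h, (∑ i, ∑ j, g i j * β i j h) • B h := by
  have h1 : ∀ (α : ι → ι → ι → ℝ) (A : ι → E), ∑ h, (∑ i, ∑ j, g i j * α i j h) • A h
      = ∑ i, ∑ j, g i j • ∑ h, α i j h • A h := by
    intro α A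
    simp only [Finset.sum_smul, Finset.smul_sum, smul_smul]
    rw [← Finset.sum_comm_cycle]
  rw [h1, h1]
  simp only [smul_add, Finset.sum_add_distrib]

lemma inv_apply_comm [DecidableEq ι] {A : Matrix ι ι ℝ} (hA : ∀ i j, A i j = A j i) (i j : ι) :
    A⁻¹ i j = A⁻¹ j i := by
  have h : A.transpose = A := Matrix.ext fun i j => hA j i
  have h2 := Matrix.transpose_nonsing_inv A
  rw [h] at h2
  exact congrFun (congrFun h2 j) i

lemma curvature_swap [DecidableEq ι] (G : EuclideanSpace ℝ ι → Matrix ι ι ℝ)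
    (x : EuclideanSpace ℝ ι) (i j k h : ι) : curvature G x i j k h = -curvature G x j i k h := by
  simp only [curvature, Finset.sum_sub_distrib]
  ring

end TensionAlgebra

/-! ### From the manifold to component matrices in a chart. -/

section Chart

open Filter Topology

variable {n : ℕ} {M : Type*} [TopologicalSpace M] [ChartedSpace (EuclideanSpace ℝ (Fin n)) M]
  {e : OpenPartialHomeomorph M (EuclideanSpace ℝ (Fin n))}

lemma tangentVec_add (x a b : EuclideanSpace ℝ (Fin n)) :
    tangentVec e x (a + b) = tangentVec e x a + tangentVec e x b :=
  map_add (mfderiv (𝓡 n) (𝓡 n) e.symm x) a b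

lemma tangentVec_smul (r : ℝ) (x a : EuclideanSpace ℝ (Fin n)) :
    tangentVec e x (r • a) = r • tangentVec e x a :=
  map_smul (mfderiv (𝓡 n) (𝓡 n) e.symm x) r a

lemma endoOf_endoComp (φ : ∀ p : M, TangentSpace (𝓡 n) p →L[ℝ] TangentSpace (𝓡 n) p)
    (x a : EuclideanSpace ℝ (Fin n)) :
    endoOf (endoComp φ e x) a
      = mfderiv (𝓡 n) (𝓡 n) e (e.symm x) (φ (e.symm x) (tangentVec e x a)) :=
  endoOf_of ((mfderiv (𝓡 n) (𝓡 n) e (e.symm x)).comp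
    ((φ (e.symm x)).comp (mfderiv (𝓡 n) (𝓡 n) e.symm x))).toLinearMap a

lemma tangentVec_endoOf (he : e ∈ IsManifold.maximalAtlas (𝓡 n) ∞ M)
    (φ : ∀ p : M, TangentSpace (𝓡 n) p →L[ℝ] TangentSpace (𝓡 n) p)
    {x : EuclideanSpace ℝ (Fin n)} (hx : x ∈ e.target) (a : EuclideanSpace ℝ (Fin n)) :
    tangentVec e x (endoOf (endoComp φ e x) a) = φ (e.symm x) (tangentVec e x a) := by
  rw [endoOf_endoComp, tangentVec_mfderiv he hx]

lemma sectionComp_eq (ξ : ∀ p : M, TangentSpace (𝓡 n) p) {x : EuclideanSpace ℝ (Fin n)}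
    (hx : x ∈ e.target) : sectionComp ξ e x = pair x (vectorComp ξ e x) := by
  have h : sectionComp ξ e x = pair (e (e.symm x)) (vectorComp ξ e x) := rfl
  rw [h, e.right_inv hx]

variable [IsManifold (𝓡 n) ∞ M]

lemma formOf_metricComp (g : Metric n M) (x a b : EuclideanSpace ℝ (Fin n)) :
    formOf (metricComp g e x) a b
      = g.inner (e.symm x) (tangentVec e x a) (tangentVec e x b) :=
  formOf_of (fun a b => g.inner (e.symm x) (tangentVec e x a) (tangentVec e x b))
    (fun a a' b => by simp [tangentVec_add]) (fun r a b => by simp [tangentVec_smul])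
    (fun a b b' => by simp [tangentVec_add]) (fun r a b => by simp [tangentVec_smul]) a b

lemma metricComp_comm (g : Metric n M) (x : EuclideanSpace ℝ (Fin n)) (i j : Fin n) :
    metricComp g e x i j = metricComp g e x j i :=
  g.symm _ _ _

lemma formOf_bergerSasakiComp (g : Metric n M)
    (φ : ∀ p : M, TangentSpace (𝓡 n) p →L[ℝ] TangentSpace (𝓡 n) p) (δ : ℝ)
    (z a b : EuclideanSpace ℝ (Fin n ⊕ Fin n)) :
    formOf (bergerSasakiComp g φ δ e z) a b = bergerSasaki g φ δ e z a b := by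
  have hb : ∀ a b : EuclideanSpace ℝ (Fin n ⊕ Fin n), base (a + b) = base a + base b :=
    fun _ _ => rfl
  have hb' : ∀ (r : ℝ) (a : EuclideanSpace ℝ (Fin n ⊕ Fin n)), base (r • a) = r • base a :=
    fun _ _ => rfl
  have hc : ∀ a b, connector (metricComp g e) z (a + b)
      = connector (metricComp g e) z a + connector (metricComp g e) z b := fun a b => by
    simp only [connector_eq, ← verticalPartL_apply, map_add]
  have hc' : ∀ (r : ℝ) a, connector (metricComp g e) z (r • a)
      = r • connector (metricComp g e) z a := fun r a => by
    simp only [connector_eq, ← verticalPartL_apply, map_smul]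
  refine formOf_of (bergerSasaki g φ δ e z) (fun a a' b => ?_) (fun r a b => ?_)
    (fun a b b' => ?_) (fun r a b => ?_) a b <;>
  simp only [bergerSasaki, hb, hb', hc, hc', tangentVec_add, tangentVec_smul, map_add, map_smul,
    add_apply, smul_apply, smul_eq_mul] <;>
  ring

/-- The base point must lie in the target: there the derivatives of `e` and `e.symm` are mutually
inverse, so the matrix of `φ` reproduces `φ`. -/
lemma bergerSasaki_eq_coordSasaki (he : e ∈ IsManifold.maximalAtlas (𝓡 n) ∞ M) (g : Metric n M)
    (φ : ∀ p : M, TangentSpace (𝓡 n) p →L[ℝ] TangentSpace (𝓡 n) p) (δ : ℝ)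
    {z : EuclideanSpace ℝ (Fin n ⊕ Fin n)} (hz : base z ∈ e.target)
    (a b : EuclideanSpace ℝ (Fin n ⊕ Fin n)) :
    bergerSasaki g φ δ e z a b = coordSasaki (metricComp g e) (endoComp φ e) δ z a b := by
  simp only [bergerSasaki, ← tangentVec_endoOf he φ hz, ← formOf_metricComp, connector_eq]
  rw [add_assoc]
  rfl

lemma bergerSasakiComp_comm (g : Metric n M)
    (φ : ∀ p : M, TangentSpace (𝓡 n) p →L[ℝ] TangentSpace (𝓡 n) p) (δ : ℝ)
    (z : EuclideanSpace ℝ (Fin n ⊕ Fin n)) (α β : Fin n ⊕ Fin n) :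
    bergerSasakiComp g φ δ e z α β = bergerSasakiComp g φ δ e z β α := by
  simp only [bergerSasakiComp, bergerSasaki, Matrix.of_apply]
  rw [g.symm _ (tangentVec e (base z) (base (EuclideanSpace.single α 1))),
    g.symm _ (tangentVec e (base z) (connector (metricComp g e) z (EuclideanSpace.single α 1)))
      (tangentVec e (base z) (connector (metricComp g e) z (EuclideanSpace.single β 1)))]
  ring

lemma IsAntiParaKahler.coord {g : Metric n M}
    {φ : ∀ p : M, TangentSpace (𝓡 n) p →L[ℝ] TangentSpace (𝓡 n) p} (hφ : IsAntiParaKahler g φ)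
    (he : e ∈ IsManifold.maximalAtlas (𝓡 n) ∞ M) {x : EuclideanSpace ℝ (Fin n)}
    (hx : x ∈ e.target) : IsAntiParaKahlerCoord (metricComp g e) (endoComp φ e) x where
  contDiff_metric i j := ((contDiffOn_metricComp he g i j).contDiffAt
    (e.open_target.mem_nhds hx)).of_le (by norm_cast)
  contDiff_endo i j := ((contDiffOn_endoComp he hφ.smooth i j).contDiffAt
    (e.open_target.mem_nhds hx)).of_le (by norm_cast)
  metric_symm := metricComp_comm g
  metric_pos := by
    filter_upwards [e.open_target.mem_nhds hx] with y hy v hv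
    rw [formOf_metricComp]
    -- A nonzero coordinate vector gives a nonzero tangent vector, since the derivative of the chart
    -- recovers it.
    refine g.pos _ _ fun h0 => hv ?_
    rw [← mfderiv_tangentVec he hy v, h0]
    exact map_zero (mfderiv (𝓡 n) (𝓡 n) e (e.symm y))
  involutive v := by
    rw [endoOf_endoComp, tangentVec_endoOf he φ hx, hφ.involutive, mfderiv_tangentVec he hx]
  isometry v w := by
    simp only [formOf_metricComp, tangentVec_endoOf he φ hx, hφ.isometry]
  parallel := by
    filter_upwards [e.open_target.mem_nhds hx] with y hy using hφ.parallel e he y hy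

end Chart

end BergerSasaki
end

/-! ### The theorem on the manifold. -/

theorem mainTheorem3 {k : ℕ} {M : Type*} [TopologicalSpace M]
    [ChartedSpace (EuclideanSpace ℝ (Fin (2 * k))) M] [IsManifold (𝓡 (2 * k)) ∞ M]
    (g : BergerSasaki.Metric (2 * k) M)
    (φ : ∀ p : M, TangentSpace (𝓡 (2 * k)) p →L[ℝ] TangentSpace (𝓡 (2 * k)) p)
    (hφ : BergerSasaki.IsAntiParaKahler g φ) (δ : ℝ)
    (ξ : ∀ p : M, TangentSpace (𝓡 (2 * k)) p)
    (hξ : ContMDiff (𝓡 (2 * k)) (𝓡 (2 * k)).tangent ∞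
      (fun p : M => (⟨p, ξ p⟩ : TangentBundle (𝓡 (2 * k)) M)))
    (e : OpenPartialHomeomorph M (EuclideanSpace ℝ (Fin (2 * k))))
    (he : e ∈ IsManifold.maximalAtlas (𝓡 (2 * k)) ∞ M)
    (p : M) (hp : p ∈ e.source) :
    let x := e p
    let G := BergerSasaki.metricComp g e
    let V := BergerSasaki.vectorComp ξ e
    let D := BergerSasaki.covDeriv G V x
    let DD := BergerSasaki.covDeriv₂ G V x
    let R := BergerSasaki.curvature G x
    let RU := BergerSasaki.curvatureUp G x
    let A := BergerSasaki.tensorA g φ δ ξ e x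
    let EH := BergerSasaki.frameH G (BergerSasaki.sectionComp ξ e x)
    (∀ i j : Fin (2 * k),
      BergerSasaki.betaField g φ δ ξ e x i j
        = ∑ h, ((1 / 2 : ℝ) * (∑ l, ∑ m, D j l * RU h i l m * V x m
                + ∑ l, ∑ m, D i l * RU h j l m * V x m)) • EH h
          + ∑ h, (-(1 / 2 : ℝ) * ∑ m, R i j m h * V x m + DD i j h
                + ∑ m, ∑ s, D i m * D j s * A m s h) • BergerSasaki.frameV h)
    ∧ BergerSasaki.tauField g φ δ ξ e x
        = ∑ h, (∑ i, ∑ j, ∑ l, ∑ m, (G x)⁻¹ i j * D j l * RU h i l m * V x m) • EH h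
          + ∑ h, (∑ i, ∑ j, (G x)⁻¹ i j * DD i j h
                + ∑ i, ∑ j, ∑ m, ∑ s, (G x)⁻¹ i j * D i m * D j s * A m s h)
              • BergerSasaki.frameV h := by
  intro x G V D DD R RU A EH
  have hx : x ∈ e.target := e.map_source hp
  have hV : ContDiffAt ℝ 2 V x := ((BergerSasaki.contDiffOn_vectorComp he hξ).contDiffAt
    (e.open_target.mem_nhds hx)).of_le (by norm_cast)
  have hF : ∀ᶠ y in nhds x, BergerSasaki.sectionComp ξ e y = BergerSasaki.pair y (V y) := by
    filter_upwards [e.open_target.mem_nhds hx] with y hy using BergerSasaki.sectionComp_eq ξ hy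
  have hS : ∀ᶠ w in nhds (BergerSasaki.pair x (V x)), ∀ a b,
      BergerSasaki.formOf (BergerSasaki.bergerSasakiComp g φ δ e w) a b
        = BergerSasaki.coordSasaki G (BergerSasaki.endoComp φ e) δ w a b := by
    -- The two metrics agree only over the chart's target, whose preimage in the tangent coordinates
    -- is a neighbourhood of the point.
    have hc : ∀ᶠ w in nhds (BergerSasaki.pair x (V x)), BergerSasaki.baseL w ∈ e.target :=
      BergerSasaki.baseL.continuous.continuousAt.eventually (e.open_target.mem_nhds hx)
    filter_upwards [hc] with w hw a b
    rw [BergerSasaki.formOf_bergerSasakiComp]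
    exact BergerSasaki.bergerSasaki_eq_coordSasaki he g φ δ hw a b
  have hβ : ∀ i j, BergerSasaki.betaField g φ δ ξ e x i j
      = ∑ h, ((1 / 2 : ℝ) * (∑ l, ∑ m, D j l * RU h i l m * V x m
              + ∑ l, ∑ m, D i l * RU h j l m * V x m)) • EH h
        + ∑ h, (-(1 / 2 : ℝ) * ∑ m, R i j m h * V x m + DD i j h
              + ∑ m, ∑ s, D i m * D j s * A m s h) • BergerSasaki.frameV h := by
    intro i j
    have h1 := BergerSasaki.secondFundamentalForm_section_eq (δ := δ) (hφ.coord he hx) hV hF hS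
      (BergerSasaki.bergerSasakiComp_comm g φ δ _) i j
    rw [← BergerSasaki.sectionComp_eq ξ hx] at h1
    exact h1
  refine ⟨hβ, ?_⟩
  have hg : ∀ i j, (G x)⁻¹ i j = (G x)⁻¹ j i :=
    BergerSasaki.inv_apply_comm (BergerSasaki.metricComp_comm g x)
  have hτ : BergerSasaki.tauField g φ δ ξ e x
      = ∑ i, ∑ j, (G x)⁻¹ i j • BergerSasaki.betaField g φ δ ξ e x i j := by
    ext γ
    simp only [WithLp.ofLp_sum, Finset.sum_apply, PiLp.smul_apply, smul_eq_mul]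
    rfl
  simp only [hτ, hβ]
  refine (BergerSasaki.sum_smul_frame (fun i j => (G x)⁻¹ i j) _ _ _ _).trans ?_
  congr 1
  · refine Finset.sum_congr rfl fun h _ => congrArg (· • EH h) ?_
    refine (BergerSasaki.sum_mul_half_add_swap hg
      fun i j => ∑ l, ∑ m, D j l * RU h i l m * V x m).trans ?_
    simp only [Finset.mul_sum, mul_assoc]
  · refine Finset.sum_congr rfl fun h _ => congrArg (· • BergerSasaki.frameV h) ?_
    -- The curvature is antisymmetric in `i, j` and the inverse metric symmetric, so this term has
    -- zero trace.
    have h1 := BergerSasaki.sum_mul_eq_zero_of_antisymm hg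
      (r := fun i j => -(1 / 2 : ℝ) * ∑ m, R i j m h * V x m) fun i j => by
        simp only [R, BergerSasaki.curvature_swap G x i j, neg_mul, Finset.sum_neg_distrib, mul_neg]
    simp only [mul_add, Finset.sum_add_distrib, h1, zero_add]
    simp only [Finset.mul_sum, mul_assoc]
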